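/- Let $\mathfrak{su}(3)$ be the real Lie algebra of traceless skew-Hermitian complex $3\times 3$ matrices. For an integer $D\ge 1$ let $\xi(D)$ be the number of isomorphism classes of irreducible complex representations of $\mathfrak{su}(3)$ of dimension exactly $D$. For real $t>0$ put $$k_t=\lfloor 2\sqrt[3]{t}\rfloor,\qquad l_t=\Big\lfloor \tfrac12\big(1+\sqrt{1+8t}\big)\Big\rfloor,\qquad y_\pm(t,x)=\frac{x-2}{2}\pm\frac12\Big(x^2-\frac{8t}{x}\Big)^{1/2},$$ $$N_t=\tfrac12\,l_t(l_t-1)-\sum_{x=k_t+1}^{l_t}\Big(\lfloor y_+(t,x)\rfloor-\lceil y_-(t,x)\rceil+1\Big).$$ Then, for every integer $D\ge 1$, there are only finitely many isomorphism classes of irreducible complex representations of $\mathfrak{su}(3)$ of dimension $D$, of dimension less than $D+\tfrac12$, and of dimension less than $D-\tfrac12$; for $t=D+\tfrac12$ and for $t=D-\tfrac12$ the number $N_t$ is exactly the number of isomorphism classes of irreducible complex representations of $\mathfrak{su}(3)$ of dimension less than $t$; and $$\xi(D)=N_{D+\frac12}-N_{D-\frac12}.$$ -/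

import Mathlib

open scoped Matrix

attribute [local instance 100] LieRing.ofAssociativeRing

namespace SU3

/-- The real Lie algebra `su(3)`: traceless skew-Hermitian complex `3 × 3` matrices, with the
commutator bracket. -/
def su3 : LieSubalgebra ℝ (Matrix (Fin 3) (Fin 3) ℂ) where
  carrier := {A | Aᴴ = -A ∧ A.trace = 0}
  zero_mem' := by simp
  add_mem' := by
    rintro A B ⟨hA, hA'⟩ ⟨hB, hB'⟩
    exact ⟨by rw [Matrix.conjTranspose_add, hA, hB, neg_add], by
      rw [Matrix.trace_add, hA', hB', add_zero]⟩
  smul_mem' := by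
    rintro c A ⟨hA, hA'⟩
    exact ⟨by rw [Matrix.conjTranspose_smul, hA, star_trivial, smul_neg], by
      rw [Matrix.trace_smul, hA', smul_zero]⟩
  lie_mem' := by
    rintro A B ⟨hA, -⟩ ⟨hB, -⟩
    refine ⟨?_, ?_⟩
    · rw [Ring.lie_def, Matrix.conjTranspose_sub, Matrix.conjTranspose_mul,
        Matrix.conjTranspose_mul, hA, hB]
      simp
    · rw [Ring.lie_def, Matrix.trace_sub, Matrix.trace_mul_comm, sub_self]

/-- A complex representation of `su(3)` on `V`: a homomorphism of real Lie algebras into the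
`ℂ`-linear endomorphisms of `V`. -/
abbrev Rep (V : Type) [AddCommGroup V] [Module ℂ V] : Type :=
  su3 →ₗ⁅ℝ⁆ Module.End ℂ V

/-- A representation is irreducible if `V ≠ 0` and the only invariant complex subspaces are
`0` and `V`. -/
def Rep.IsIrreducible {V : Type} [AddCommGroup V] [Module ℂ V] (ρ : Rep V) : Prop :=
  Nontrivial V ∧ ∀ W : Submodule ℂ V, (∀ X : su3, ∀ w ∈ W, ρ X w ∈ W) → W = ⊥ ∨ W = ⊤

/-- Two representations are isomorphic if some `ℂ`-linear isomorphism intertwines them. -/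
def Rep.Isom {V W : Type} [AddCommGroup V] [Module ℂ V] [AddCommGroup W] [Module ℂ W]
    (ρ : Rep V) (σ : Rep W) : Prop :=
  ∃ T : V ≃ₗ[ℂ] W, ∀ (X : su3) (v : V), T (ρ X v) = σ X (T v)

/-- The irreducible representations on `ℂ^d`. -/
def Irrep (d : ℕ) : Type := {ρ : Rep (Fin d → ℂ) // ρ.IsIrreducible}

/-- Isomorphism as an equivalence relation on the irreducible representations on `ℂ^d`. -/
def irrepSetoid (d : ℕ) : Setoid (Irrep d) where
  r ρ σ := ρ.1.Isom σ.1
  iseqv :=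
    { refl := fun _ => ⟨LinearEquiv.refl ℂ _, fun _ _ => rfl⟩
      symm := by
        rintro ρ σ ⟨T, hT⟩
        exact ⟨T.symm, fun X v => by rw [LinearEquiv.symm_apply_eq, hT, T.apply_symm_apply]⟩
      trans := by
        rintro ρ σ τ ⟨S, hS⟩ ⟨T, hT⟩
        exact ⟨S.trans T, fun X v => by
          rw [LinearEquiv.trans_apply, LinearEquiv.trans_apply, hS, hT]⟩ }

/-- Isomorphism classes of irreducible complex representations of `su(3)` of dimension `d`
(each such representation is isomorphic to one on `ℂ^d`). -/
def IrrepClass (d : ℕ) : Type := Quotient (irrepSetoid d)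

/-- `ξ(d)`: the number of irreducible representations of dimension `d`, up to isomorphism. -/
noncomputable def xi (d : ℕ) : ℕ := Nat.card (IrrepClass d)

/-- Isomorphism classes of irreducible representations of dimension less than the real `t`. -/
def IrrepClassBelow (t : ℝ) : Type := {c : Σ d : ℕ, IrrepClass d // (c.1 : ℝ) < t}

/-- The number of irreducible representations of dimension less than `t`, up to isomorphism. -/
noncomputable def countBelow (t : ℝ) : ℕ := Nat.card (IrrepClassBelow t)

/-- `k_t = ⌊2 t^(1/3)⌋`. -/
noncomputable def kBound (t : ℝ) : ℤ := ⌊2 * t ^ (1 / 3 : ℝ)⌋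

/-- `l_t = ⌊(1 + √(1 + 8 t)) / 2⌋`. -/
noncomputable def lBound (t : ℝ) : ℤ := ⌊(1 / 2 : ℝ) * (1 + √(1 + 8 * t))⌋

/-- `y₊ = (x - 2) / 2 + √(x² - 8 t / x) / 2`. -/
noncomputable def yPlus (t x : ℝ) : ℝ := (x - 2) / 2 + (1 / 2) * √(x ^ 2 - 8 * t / x)

/-- `y₋ = (x - 2) / 2 - √(x² - 8 t / x) / 2`. -/
noncomputable def yMinus (t x : ℝ) : ℝ := (x - 2) / 2 - (1 / 2) * √(x ^ 2 - 8 * t / x)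

/-- The explicit expression
`N_t = l_t (l_t - 1) / 2 - ∑_{x = k_t + 1}^{l_t} (⌊y₊⌋ - ⌈y₋⌉ + 1)`. -/
noncomputable def N (t : ℝ) : ℝ :=
  (1 / 2 : ℝ) * (lBound t : ℝ) * ((lBound t : ℝ) - 1) -
    ∑ x ∈ Finset.Icc (kBound t + 1) (lBound t),
      ((⌊yPlus t (x : ℝ)⌋ : ℝ) - (⌈yMinus t (x : ℝ)⌉ : ℝ) + 1)

end SU3

/-! The irreducible representations are classified by pairs `(p, q)` of natural numbers, with
dimension `(p + 1) (q + 1) (p + q + 2) / 2`; the formula for `N` is then a lattice point count.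

Classification. Complexifying a representation gives Chevalley generators, from which the
representation can be recovered (`Rep.act_chevalley`), so irreducibility and isomorphism may be
tested on the generators. A finite-dimensional system has a highest weight vector, whose weight is a
pair of natural numbers. Two irreducible systems of equal highest weight are isomorphic: in their
direct sum, the highest weight vectors together generate the graph of an isomorphism
(`isom_of_isHighestWeightVector`). Existence comes from an explicit model on Gelfand–Tsetlin
patterns with rows `(p + q, q, 0)`, `(q + a, q - b)`, `(q + a - j)`, with rational matrix
coefficients. In it the Serre relations hold, the vectors killed by the raising operators form a
line, and the top vector generates everything (`gtSystem_isIrreducible`).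

Counting. Put `x = p + q + 2`, `y = p` and `t = r + 1/2`. Each `x ≥ 1` carries `x - 1` pairs, of
dimension `(y + 1) (x - 1 - y) x / 2`. If `x > l_t`, all of them are too large, because `(p + 1) (q
+ 1) ≥ x - 1`. If `x ≤ k_t`, none is, because `(y + 1) (x - 1 - y) ≤ x ^ 2 / 4`. In between, the
pairs of dimension above `t` are the integers between the two roots `y₋` and `y₊` of a quadratic.
Subtracting these from `∑ (x - 1) = l_t (l_t - 1) / 2` gives `N` (`card_weylDim_le`), and the counts
at `D + 1/2` and `D - 1/2` differ by the pairs of dimension exactly `D`. -/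

namespace SU3

/-! ### Highest weight theory for Chevalley generators of type `A₂`. -/

/-- The entries of the Cartan matrix of type `A₂`. -/
def cartanEntry (i j : Fin 2) : ℂ := if i = j then 2 else -1

/-- Endomorphisms satisfying the relations of the Chevalley generators of `sl(3)`, the Serre
relations excepted. -/
@[ext]
structure ChevalleySystem (V : Type*) [AddCommGroup V] [Module ℂ V] where
  e : Fin 2 → Module.End ℂ V
  f : Fin 2 → Module.End ℂ V
  h : Fin 2 → Module.End ℂ V
  lie_h_h : ∀ i j, ⁅h i, h j⁆ = 0
  lie_h_e : ∀ i j, ⁅h i, e j⁆ = cartanEntry i j • e j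
  lie_h_f : ∀ i j, ⁅h i, f j⁆ = -cartanEntry i j • f j
  lie_e_f : ∀ i j, ⁅e i, f j⁆ = if i = j then h i else 0

namespace ChevalleySystem

variable {V W : Type*} [AddCommGroup V] [Module ℂ V] [AddCommGroup W] [Module ℂ W]

lemma h_h_apply (C : ChevalleySystem V) (i j : Fin 2) (v : V) :
    C.h i (C.h j v) = C.h j (C.h i v) := by
  have := LinearMap.congr_fun (C.lie_h_h i j) v
  simpa [Ring.lie_def, sub_eq_zero] using this

lemma h_e_apply (C : ChevalleySystem V) (i j : Fin 2) (v : V) :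
    C.h i (C.e j v) = C.e j (C.h i v) + cartanEntry i j • C.e j v := by
  have := LinearMap.congr_fun (C.lie_h_e i j) v
  simpa [Ring.lie_def, sub_eq_iff_eq_add'] using this

lemma h_f_apply (C : ChevalleySystem V) (i j : Fin 2) (v : V) :
    C.h i (C.f j v) = C.f j (C.h i v) - cartanEntry i j • C.f j v := by
  have := LinearMap.congr_fun (C.lie_h_f i j) v
  simp only [Ring.lie_def, LinearMap.sub_apply, Module.End.mul_apply,
    neg_smul, sub_eq_iff_eq_add'] at this
  rw [this, sub_eq_add_neg]
  rfl

lemma e_f_apply (C : ChevalleySystem V) (i j : Fin 2) (v : V) :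
    C.e i (C.f j v) = C.f j (C.e i v) + if i = j then C.h i v else 0 := by
  have := LinearMap.congr_fun (C.lie_e_f i j) v
  split_ifs with hij <;> simpa [Ring.lie_def, sub_eq_iff_eq_add', hij] using this

/-- Invariance of a subspace under the raising and lowering operators. -/
def IsInvariant (C : ChevalleySystem V) (U : Submodule ℂ V) : Prop :=
  ∀ i, ∀ u ∈ U, C.e i u ∈ U ∧ C.f i u ∈ U

/-- `V ≠ 0` and the only invariant subspaces are `0` and `V`. -/
def IsIrreducible (C : ChevalleySystem V) : Prop :=
  Nontrivial V ∧ ∀ U : Submodule ℂ V, C.IsInvariant U → U = ⊥ ∨ U = ⊤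

/-- A nonzero vector of weight `μ` killed by the raising operators. -/
structure IsHighestWeightVector (C : ChevalleySystem V) (μ : Fin 2 → ℂ) (v : V) : Prop where
  ne_zero : v ≠ 0
  e_apply : ∀ i, C.e i v = 0
  h_apply : ∀ i, C.h i v = μ i • v

/-- The principal grading operator, for which every raising operator has degree one. -/
def grading (C : ChevalleySystem V) : Module.End ℂ V := C.h 0 + C.h 1

lemma grading_e_apply (C : ChevalleySystem V) (j : Fin 2) (v : V) :
    C.grading (C.e j v) = C.e j (C.grading v) + C.e j v := by
  fin_cases j <;>
    simp only [grading, LinearMap.add_apply, h_e_apply, cartanEntry, map_add] <;> simp <;> module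

lemma grading_f_apply (C : ChevalleySystem V) (j : Fin 2) (v : V) :
    C.grading (C.f j v) = C.f j (C.grading v) - C.f j v := by
  fin_cases j <;>
    simp only [grading, LinearMap.add_apply, h_f_apply, cartanEntry, map_add] <;> simp <;> module

/-- Raising operators increase the eigenvalue of `grading` by one, so they kill the eigenspace whose
eigenvalue has maximal real part. That eigenspace is stable under `h 0`, which therefore has an
eigenvector in it; `h 1` is the difference of `grading` and `h 0`. -/
theorem exists_isHighestWeightVector [FiniteDimensional ℂ V] [Nontrivial V]
    (C : ChevalleySystem V) : ∃ μ v, C.IsHighestWeightVector μ v := by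
  have hfin : {z : ℂ | C.grading.HasEigenvalue z}.Finite :=
    Module.End.finite_hasEigenvalue C.grading
  obtain ⟨z, hz, hmax⟩ := Set.exists_max_image _ Complex.re hfin
    (Module.End.exists_eigenvalue C.grading)
  set U := C.grading.eigenspace z with hU
  have hstab : ∀ u ∈ U, C.h 0 u ∈ U := fun u hu => by
    rw [hU, Module.End.mem_eigenspace_iff] at hu ⊢
    have : C.grading (C.h 0 u) = C.h 0 (C.grading u) := by
      simp [grading, C.h_h_apply 1 0]
    rw [this, hu, map_smul]
  have : Nontrivial U := Submodule.nontrivial_iff_ne_bot.mpr hz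
  obtain ⟨c, hc⟩ := Module.End.exists_eigenvalue ((C.h 0).restrict hstab)
  obtain ⟨⟨v, hvU⟩, hv⟩ := hc.exists_hasEigenvector
  have hv0 : v ≠ 0 := fun h => hv.2 (Subtype.ext h)
  have hh0 : C.h 0 v = c • v := congrArg Subtype.val hv.apply_eq_smul
  have hg : C.grading v = z • v := Module.End.mem_eigenspace_iff.mp hvU
  refine ⟨![c, z - c], v, hv0, fun i => ?_, fun i => ?_⟩
  · by_contra hne
    have hz' : C.grading.HasEigenvalue (z + 1) := by
      refine Module.End.hasEigenvalue_of_hasEigenvector (x := C.e i v) ⟨?_, hne⟩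
      rw [Module.End.mem_eigenspace_iff, grading_e_apply, hg, map_smul, add_smul, one_smul]
    have := hmax _ hz'
    simp at this
    linarith
  · fin_cases i
    · exact hh0
    · have : C.h 1 v = C.grading v - C.h 0 v := by simp [grading]
      simp [this, hg, hh0, sub_smul]

theorem IsHighestWeightVector.exists_nat [FiniteDimensional ℂ V] {C : ChevalleySystem V}
    {μ : Fin 2 → ℂ} {v : V} (hv : C.IsHighestWeightVector μ v) (i : Fin 2) :
    ∃ n : ℕ, μ i = n := by
  -- An `IsSl2Triple` requires `h ≠ 0`, which is only guaranteed when the eigenvalue is nonzero.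
  by_cases hμ : μ i = 0
  · exact ⟨0, by simpa using hμ⟩
  have t : IsSl2Triple (C.h i) (C.e i) (C.f i) :=
    { h_ne_zero := fun h0 => by
        have := hv.h_apply i
        rw [h0, LinearMap.zero_apply, eq_comm, smul_eq_zero] at this
        exact this.elim hμ hv.ne_zero
      lie_e_f := by simp [C.lie_e_f]
      lie_h_e_nsmul := by
        rw [C.lie_h_e]
        simp only [cartanEntry, if_true]
        module
      lie_h_f_nsmul := by
        rw [C.lie_h_f]
        simp only [cartanEntry, if_true]
        module }
  have P : t.HasPrimitiveVectorWith v (μ i) :=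
    { ne_zero := hv.ne_zero
      lie_h := hv.h_apply i
      lie_e := hv.e_apply i }
  exact P.exists_nat

/-- The successive images of `v` under a list of lowering operators. -/
def word (C : ChevalleySystem V) (v : V) (l : List (Fin 2)) : V :=
  l.foldr (fun i x => C.f i x) v

/-- The span of all images of `v` under products of lowering operators. -/
def wordSpan (C : ChevalleySystem V) (v : V) : Submodule ℂ V :=
  Submodule.span ℂ (Set.range (C.word v))

lemma word_mem_wordSpan (C : ChevalleySystem V) (v : V) (l : List (Fin 2)) :
    C.word v l ∈ C.wordSpan v := Submodule.subset_span ⟨l, rfl⟩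

lemma self_mem_wordSpan (C : ChevalleySystem V) (v : V) : v ∈ C.wordSpan v :=
  C.word_mem_wordSpan v []

lemma f_mem_wordSpan (C : ChevalleySystem V) (v : V) (i : Fin 2) {u : V}
    (hu : u ∈ C.wordSpan v) : C.f i u ∈ C.wordSpan v := by
  induction hu using Submodule.span_induction with
  | mem x hx =>
    obtain ⟨l, rfl⟩ := hx
    exact C.word_mem_wordSpan v (i :: l)
  | zero => simp
  | add x y _ _ hx hy => rw [map_add]; exact add_mem hx hy
  | smul c x _ hx => rw [map_smul]; exact Submodule.smul_mem _ _ hx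

lemma IsHighestWeightVector.h_word {C : ChevalleySystem V} {μ : Fin 2 → ℂ} {v : V}
    (hv : C.IsHighestWeightVector μ v) (i : Fin 2) (l : List (Fin 2)) :
    ∃ c : ℂ, C.h i (C.word v l) = c • C.word v l := by
  induction l with
  | nil => exact ⟨μ i, hv.h_apply i⟩
  | cons j l ih =>
    obtain ⟨c, hc⟩ := ih
    refine ⟨c - cartanEntry i j, ?_⟩
    change C.h i (C.f j (C.word v l)) = _ • C.f j (C.word v l)
    rw [h_f_apply, hc, map_smul, sub_smul]

/-- Commuting `e i` past the leading `f j` leaves a shorter word, plus a term in `h i`, which acts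
on words by scalars. -/
lemma IsHighestWeightVector.e_word_mem {C : ChevalleySystem V} {μ : Fin 2 → ℂ} {v : V}
    (hv : C.IsHighestWeightVector μ v) (i : Fin 2) (l : List (Fin 2)) :
    C.e i (C.word v l) ∈ C.wordSpan v := by
  induction l with
  | nil =>
    change C.e i v ∈ _
    rw [hv.e_apply]
    exact zero_mem _
  | cons j l ih =>
    change C.e i (C.f j (C.word v l)) ∈ _
    rw [e_f_apply]
    refine add_mem (C.f_mem_wordSpan v j ih) ?_
    split_ifs
    · obtain ⟨c, hc⟩ := hv.h_word i l
      rw [hc]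
      exact Submodule.smul_mem _ _ (C.word_mem_wordSpan v l)
    · exact zero_mem _

lemma IsHighestWeightVector.isInvariant_wordSpan {C : ChevalleySystem V} {μ : Fin 2 → ℂ} {v : V}
    (hv : C.IsHighestWeightVector μ v) : C.IsInvariant (C.wordSpan v) := by
  refine fun i u hu => ⟨?_, C.f_mem_wordSpan v i hu⟩
  induction hu using Submodule.span_induction with
  | mem x hx =>
    obtain ⟨l, rfl⟩ := hx
    exact hv.e_word_mem i l
  | zero => simp
  | add x y _ _ hx hy => rw [map_add]; exact add_mem hx hy
  | smul c x _ hx => rw [map_smul]; exact Submodule.smul_mem _ _ hx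

lemma IsHighestWeightVector.grading_word {C : ChevalleySystem V} {μ : Fin 2 → ℂ} {v : V}
    (hv : C.IsHighestWeightVector μ v) (l : List (Fin 2)) :
    C.grading (C.word v l) = (μ 0 + μ 1 - l.length) • C.word v l := by
  induction l with
  | nil => simp [word, grading, hv.h_apply, add_smul]
  | cons j l ih =>
    change C.grading (C.f j (C.word v l)) = _ • C.f j (C.word v l)
    rw [grading_f_apply, ih, map_smul]
    push_cast [List.length_cons]
    module

/-- In the span of words on a highest weight vector, the top graded part is a line. -/
lemma IsHighestWeightVector.eq_smul_of_mem_wordSpan {C : ChevalleySystem V} {μ : Fin 2 → ℂ}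
    {v : V} (hv : C.IsHighestWeightVector μ v) {u : V} (hu : u ∈ C.wordSpan v)
    (hgu : C.grading u = (μ 0 + μ 1) • u) : ∃ c : ℂ, u = c • v := by
  -- Every nonempty word has a `grading` eigenvalue different from that of `v`. So `u - c • v` lies
  -- in the sum `N` of the other eigenspaces and also in the top one, and independence of
  -- eigenspaces makes it zero.
  set N : Submodule ℂ V := ⨆ z, ⨆ (_ : z ≠ μ 0 + μ 1), C.grading.eigenspace z with hN
  have key : ∃ c : ℂ, u - c • v ∈ N := by
    clear hgu
    induction hu using Submodule.span_induction with
    | mem x hx =>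
      obtain ⟨l, rfl⟩ := hx
      cases l with
      | nil => exact ⟨1, by simp [word]⟩
      | cons j l =>
        refine ⟨0, ?_⟩
        rw [zero_smul, sub_zero]
        refine Submodule.mem_iSup_of_mem (μ 0 + μ 1 - (j :: l).length)
          (Submodule.mem_iSup_of_mem ?_ (Module.End.mem_eigenspace_iff.mpr (hv.grading_word _)))
        rw [Ne, sub_eq_self]
        exact_mod_cast Nat.succ_ne_zero l.length
    | zero => exact ⟨0, by simp⟩
    | add x y _ _ hx hy =>
      obtain ⟨c, hc⟩ := hx
      obtain ⟨d, hd⟩ := hy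
      exact ⟨c + d, by convert add_mem hc hd using 1; module⟩
    | smul a x _ hx =>
      obtain ⟨c, hc⟩ := hx
      exact ⟨a * c, by convert N.smul_mem a hc using 1; module⟩
  obtain ⟨c, hc⟩ := key
  refine ⟨c, sub_eq_zero.mp ?_⟩
  refine Submodule.disjoint_def.mp (C.grading.eigenspaces_iSupIndep (μ 0 + μ 1)) _ ?_ hc
  rw [Module.End.mem_eigenspace_iff, map_sub, hgu, map_smul]
  have : C.grading v = (μ 0 + μ 1) • v := by simp [grading, hv.h_apply, add_smul]
  rw [this]
  module

/-- The direct sum of two systems. -/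
def prod (C : ChevalleySystem V) (D : ChevalleySystem W) : ChevalleySystem (V × W) where
  e i := (C.e i).prodMap (D.e i)
  f i := (C.f i).prodMap (D.f i)
  h i := (C.h i).prodMap (D.h i)
  lie_h_h i j := LinearMap.ext fun x => by
    simp [Ring.lie_def, C.h_h_apply i j, D.h_h_apply i j]
  lie_h_e i j := LinearMap.ext fun x => by
    simp [Ring.lie_def, C.h_e_apply i j, D.h_e_apply i j]
  lie_h_f i j := LinearMap.ext fun x => by
    simp [Ring.lie_def, C.h_f_apply i j, D.h_f_apply i j]
  lie_e_f i j := LinearMap.ext fun x => by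
    have h1 := C.e_f_apply i j x.1
    have h2 := D.e_f_apply i j x.2
    split_ifs at h1 h2 ⊢ <;> simp [Ring.lie_def, h1, h2]

/-- Isomorphism of systems. -/
def Isom (C : ChevalleySystem V) (D : ChevalleySystem W) : Prop :=
  ∃ T : V ≃ₗ[ℂ] W, ∀ i v, T (C.e i v) = D.e i (T v) ∧ T (C.f i v) = D.f i (T v)

/-- Irreducible systems with the same highest weight are isomorphic. -/
theorem isom_of_isHighestWeightVector {C : ChevalleySystem V} {D : ChevalleySystem W}
    (hC : C.IsIrreducible) (hD : D.IsIrreducible) {μ : Fin 2 → ℂ} {v : V} {w : W}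
    (hv : C.IsHighestWeightVector μ v) (hw : D.IsHighestWeightVector μ w) : C.Isom D := by
  have hvw : (C.prod D).IsHighestWeightVector μ (v, w) :=
    { ne_zero := fun h => hv.ne_zero (congrArg Prod.fst h)
      e_apply := fun i => Prod.ext (hv.e_apply i) (hw.e_apply i)
      h_apply := fun i => Prod.ext (hv.h_apply i) (hw.h_apply i) }
  -- `U` is shown to be the graph of an isomorphism: both projections are bijective on it.
  set U := (C.prod D).wordSpan (v, w) with hUdef
  have hU : (C.prod D).IsInvariant U := hvw.isInvariant_wordSpan
  have hmem : (v, w) ∈ U := (C.prod D).self_mem_wordSpan _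
  have hfst : Function.Injective ((LinearMap.fst ℂ V W).domRestrict U) := by
    rw [← LinearMap.ker_eq_bot, LinearMap.ker_eq_bot']
    rintro ⟨⟨x, y⟩, hxy⟩ (rfl : x = 0)
    -- The kernel of the first projection is an invariant subspace of `W`. If it were all of `W`,
    -- then `(0, w)` would be a vector of top degree in `U` not proportional to `(v, w)`.
    have hinv : D.IsInvariant (U.comap (LinearMap.inr ℂ V W)) := fun i u hu => by
      have := hU i _ hu
      simpa [prod] using this
    rcases hD.2 _ hinv with h | h
    · have : y ∈ U.comap (LinearMap.inr ℂ V W) := hxy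
      rw [h, Submodule.mem_bot] at this
      simp [this]
    · have h0 : w ∈ U.comap (LinearMap.inr ℂ V W) := h ▸ Submodule.mem_top
      obtain ⟨c, hc⟩ := hvw.eq_smul_of_mem_wordSpan (u := (0, w)) h0 (by
        simp [grading, prod, hw.h_apply, add_smul])
      have h1 : (0 : V) = c • v := congrArg Prod.fst hc
      have h2 : w = c • w := congrArg Prod.snd hc
      rw [eq_comm, smul_eq_zero, or_iff_left hv.ne_zero] at h1
      rw [h1, zero_smul] at h2
      exact absurd h2 hw.ne_zero
  have hsnd : Function.Injective ((LinearMap.snd ℂ V W).domRestrict U) := by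
    rw [← LinearMap.ker_eq_bot, LinearMap.ker_eq_bot']
    rintro ⟨⟨x, y⟩, hxy⟩ (rfl : y = 0)
    have hinv : C.IsInvariant (U.comap (LinearMap.inl ℂ V W)) := fun i u hu => by
      have := hU i _ hu
      simpa [prod] using this
    rcases hC.2 _ hinv with h | h
    · have : x ∈ U.comap (LinearMap.inl ℂ V W) := hxy
      rw [h, Submodule.mem_bot] at this
      simp [this]
    · have h0 : v ∈ U.comap (LinearMap.inl ℂ V W) := h ▸ Submodule.mem_top
      obtain ⟨c, hc⟩ := hvw.eq_smul_of_mem_wordSpan (u := (v, 0)) h0 (by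
        simp [grading, prod, hv.h_apply, add_smul])
      have h1 : v = c • v := congrArg Prod.fst hc
      have h2 : (0 : W) = c • w := congrArg Prod.snd hc
      rw [eq_comm, smul_eq_zero, or_iff_left hw.ne_zero] at h2
      rw [h2, zero_smul] at h1
      exact absurd h1 hv.ne_zero
  have hfst' : Function.Surjective ((LinearMap.fst ℂ V W).domRestrict U) := by
    have hinv : C.IsInvariant (U.map (LinearMap.fst ℂ V W)) := by
      rintro i _ ⟨u, hu, rfl⟩
      exact ⟨⟨_, (hU i u hu).1, rfl⟩, ⟨_, (hU i u hu).2, rfl⟩⟩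
    have hv' : v ∈ U.map (LinearMap.fst ℂ V W) := ⟨_, hmem, rfl⟩
    rcases hC.2 _ hinv with h | h
    · rw [h] at hv'
      exact absurd hv' hv.ne_zero
    · intro x
      obtain ⟨u, hu, rfl⟩ : x ∈ U.map (LinearMap.fst ℂ V W) := h ▸ Submodule.mem_top
      exact ⟨⟨u, hu⟩, rfl⟩
  have hsnd' : Function.Surjective ((LinearMap.snd ℂ V W).domRestrict U) := by
    have hinv : D.IsInvariant (U.map (LinearMap.snd ℂ V W)) := by
      rintro i _ ⟨u, hu, rfl⟩
      exact ⟨⟨_, (hU i u hu).1, rfl⟩, ⟨_, (hU i u hu).2, rfl⟩⟩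
    have hw' : w ∈ U.map (LinearMap.snd ℂ V W) := ⟨_, hmem, rfl⟩
    rcases hD.2 _ hinv with h | h
    · rw [h] at hw'
      exact absurd hw' hw.ne_zero
    · intro x
      obtain ⟨u, hu, rfl⟩ : x ∈ U.map (LinearMap.snd ℂ V W) := h ▸ Submodule.mem_top
      exact ⟨⟨u, hu⟩, rfl⟩
  set P := LinearEquiv.ofBijective _ ⟨hfst, hfst'⟩
  set Q := LinearEquiv.ofBijective _ ⟨hsnd, hsnd'⟩
  refine ⟨P.symm.trans Q, fun i x => ?_⟩
  obtain ⟨⟨u, hu⟩, rfl⟩ := P.surjective x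
  have h1 : C.e i (P ⟨u, hu⟩) = P ⟨_, (hU i u hu).1⟩ := rfl
  have h2 : C.f i (P ⟨u, hu⟩) = P ⟨_, (hU i u hu).2⟩ := rfl
  simp only [h1, h2, LinearEquiv.trans_apply, LinearEquiv.symm_apply_apply]
  exact ⟨rfl, rfl⟩

/-- Intertwining the `e i` and `f i` suffices, since `h i` is their commutator. -/
lemma IsHighestWeightVector.map {C : ChevalleySystem V} {D : ChevalleySystem W}
    {μ : Fin 2 → ℂ} {v : V} (hv : C.IsHighestWeightVector μ v) (T : V ≃ₗ[ℂ] W)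
    (hT : ∀ i v, T (C.e i v) = D.e i (T v) ∧ T (C.f i v) = D.f i (T v)) :
    D.IsHighestWeightVector μ (T v) where
  ne_zero := by simpa using hv.ne_zero
  e_apply i := by rw [← (hT i v).1, hv.e_apply, map_zero]
  h_apply i := by
    have h1 := C.e_f_apply i i v
    have h2 := D.e_f_apply i i (T v)
    rw [← (hT i _).2, ← (hT i _).1, h1, ← (hT i v).1] at h2
    simpa [hv.e_apply, hv.h_apply] using h2.symm

end ChevalleySystem

end SU3

/-! ### Complexification: from representations of `su3` to Chevalley generators. -/

namespace SU3

namespace ChevalleySystem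

variable {V W : Type*} [AddCommGroup V] [Module ℂ V] [AddCommGroup W] [Module ℂ W]

/-- The action of a traceless matrix attached to a system of Chevalley generators. -/
def act (C : ChevalleySystem V) : Matrix (Fin 3) (Fin 3) ℂ →ₗ[ℂ] Module.End ℂ V where
  toFun A := A 0 1 • C.e 0 + A 1 2 • C.e 1 + A 0 2 • ⁅C.e 0, C.e 1⁆ + A 1 0 • C.f 0 +
    A 2 1 • C.f 1 + A 2 0 • ⁅C.f 1, C.f 0⁆ + A 0 0 • C.h 0 + (A 0 0 + A 1 1) • C.h 1
  map_add' A B := by simp only [Matrix.add_apply]; module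
  map_smul' c A := by simp only [Matrix.smul_apply, smul_eq_mul, RingHom.id_apply]; module

lemma act_apply (C : ChevalleySystem V) (A : Matrix (Fin 3) (Fin 3) ℂ) :
    C.act A = A 0 1 • C.e 0 + A 1 2 • C.e 1 + A 0 2 • ⁅C.e 0, C.e 1⁆ + A 1 0 • C.f 0 +
      A 2 1 • C.f 1 + A 2 0 • ⁅C.f 1, C.f 0⁆ + A 0 0 • C.h 0 + (A 0 0 + A 1 1) • C.h 1 := rfl

lemma h_apply_eq (C : ChevalleySystem V) (i : Fin 2) (v : V) :
    C.h i v = C.e i (C.f i v) - C.f i (C.e i v) := by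
  rw [C.e_f_apply i i v, if_pos rfl, add_sub_cancel_left]

lemma IsInvariant.act_mem {C : ChevalleySystem V} {U : Submodule ℂ V} (hU : C.IsInvariant U)
    (A : Matrix (Fin 3) (Fin 3) ℂ) {u : V} (hu : u ∈ U) : C.act A u ∈ U := by
  have he : ∀ i, ∀ u ∈ U, C.e i u ∈ U := fun i u hu => (hU i u hu).1
  have hf : ∀ i, ∀ u ∈ U, C.f i u ∈ U := fun i u hu => (hU i u hu).2
  have hh : ∀ i, C.h i u ∈ U := fun i => by
    rw [h_apply_eq]
    exact sub_mem (he _ _ (hf _ _ hu)) (hf _ _ (he _ _ hu))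
  have h1 : ⁅C.e 0, C.e 1⁆ u ∈ U :=
    sub_mem (he _ _ (he _ _ hu)) (he _ _ (he _ _ hu))
  have h2 : ⁅C.f 1, C.f 0⁆ u ∈ U :=
    sub_mem (hf _ _ (hf _ _ hu)) (hf _ _ (hf _ _ hu))
  simp only [act_apply, LinearMap.add_apply, LinearMap.smul_apply]
  exact add_mem (add_mem (add_mem (add_mem (add_mem (add_mem (add_mem
    (U.smul_mem _ (he _ _ hu)) (U.smul_mem _ (he _ _ hu))) (U.smul_mem _ h1))
    (U.smul_mem _ (hf _ _ hu))) (U.smul_mem _ (hf _ _ hu))) (U.smul_mem _ h2))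
    (U.smul_mem _ (hh _))) (U.smul_mem _ (hh _))

lemma map_act {C : ChevalleySystem V} {D : ChevalleySystem W} (T : V ≃ₗ[ℂ] W)
    (hT : ∀ i v, T (C.e i v) = D.e i (T v) ∧ T (C.f i v) = D.f i (T v))
    (A : Matrix (Fin 3) (Fin 3) ℂ) (v : V) : T (C.act A v) = D.act A (T v) := by
  have he := fun i v => (hT i v).1
  have hf := fun i v => (hT i v).2
  simp only [act_apply, LinearMap.add_apply, LinearMap.smul_apply, Ring.lie_def,
    LinearMap.sub_apply, Module.End.mul_apply, map_add, map_smul, map_sub, h_apply_eq, he, hf]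

end ChevalleySystem

/-- The skew-Hermitian part of the traceless part of a matrix. -/
noncomputable def skewPart : Matrix (Fin 3) (Fin 3) ℂ →ₗ[ℝ] su3 where
  toFun A := ⟨(1 / 2 : ℝ) • ((A - Aᴴ) - ((A - Aᴴ).trace / 3) • (1 : Matrix (Fin 3) (Fin 3) ℂ)), by
    refine ⟨?_, ?_⟩
    · rw [Matrix.conjTranspose_smul, Matrix.conjTranspose_sub, Matrix.conjTranspose_sub,
        Matrix.conjTranspose_conjTranspose, Matrix.conjTranspose_smul, Matrix.conjTranspose_one,
        star_div₀ _ (3 : ℂ), ← Matrix.trace_conjTranspose, Matrix.conjTranspose_sub,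
        Matrix.conjTranspose_conjTranspose, star_trivial, ← neg_sub A, Matrix.trace_neg]
      simp only [star_ofNat]
      module
    · simp [Matrix.trace_sub, Matrix.trace_smul]⟩
  map_add' A B := Subtype.ext <| by
    simp only [Matrix.conjTranspose_add, add_sub_add_comm, Matrix.trace_add,
      AddMemClass.coe_add, ← smul_add, add_div, add_smul]
  map_smul' c A := Subtype.ext <| by
    simp only [Matrix.conjTranspose_smul, star_trivial, ← smul_sub, Matrix.trace_smul,
      RingHom.id_apply]
    rw [smul_div_assoc, smul_assoc, ← smul_sub, smul_comm]
    rfl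

/-- Traceless matrices decompose as `su3 ⊕ I • su3`, and `skewPart` is the projection onto the first
summand. -/
lemma skewPart_add (X Y : su3) :
    skewPart ((X : Matrix (Fin 3) (Fin 3) ℂ) + Complex.I • (Y : Matrix (Fin 3) (Fin 3) ℂ)) = X := by
  obtain ⟨X, hX, hX'⟩ := X
  obtain ⟨Y, hY, hY'⟩ := Y
  refine Subtype.ext ?_
  have : X + Complex.I • Y - (X + Complex.I • Y)ᴴ = (2 : ℝ) • X := by
    rw [Matrix.conjTranspose_add, Matrix.conjTranspose_smul, hX, hY, Complex.star_def,
      Complex.conj_I]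
    module
  simp only [skewPart, LinearMap.coe_mk, AddHom.coe_mk, this, Matrix.trace_smul, hX', smul_zero, zero_div, zero_smul, sub_zero]
  module

lemma exists_eq_add_I_smul {A : Matrix (Fin 3) (Fin 3) ℂ} (hA : A.trace = 0) :
    ∃ X Y : su3, A = (X : Matrix (Fin 3) (Fin 3) ℂ) +
      Complex.I • (Y : Matrix (Fin 3) (Fin 3) ℂ) := by
  refine ⟨⟨(1 / 2 : ℂ) • (A - Aᴴ), ?_, ?_⟩, ⟨(-Complex.I / 2) • (A + Aᴴ), ?_, ?_⟩, ?_⟩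
  · rw [Matrix.conjTranspose_smul, Matrix.conjTranspose_sub, Matrix.conjTranspose_conjTranspose]
    simp only [one_div, star_inv₀, star_ofNat]
    module
  · simp [Matrix.trace_smul, Matrix.trace_sub, hA]
  · rw [Matrix.conjTranspose_smul, Matrix.conjTranspose_add, Matrix.conjTranspose_conjTranspose]
    simp only [star_div₀, star_neg, star_ofNat, Complex.star_def, Complex.conj_I]
    module
  · simp [Matrix.trace_smul, Matrix.trace_add, hA]
  · simp only [smul_smul]
    rw [show Complex.I * (-Complex.I / 2) = 1 / 2 by
      rw [mul_div_assoc', mul_neg, Complex.I_mul_I, neg_neg]]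
    module

variable {V W : Type} [AddCommGroup V] [Module ℂ V] [AddCommGroup W] [Module ℂ W]

lemma I_smul_I_smul {M : Type*} [AddCommGroup M] [Module ℂ M] (x : M) :
    Complex.I • Complex.I • x = -x := by
  rw [smul_smul, Complex.I_mul_I, neg_one_smul]

/-- The complexification of a representation, extended by zero to scalar matrices. -/
noncomputable def Rep.complexify (ρ : Rep V) : Matrix (Fin 3) (Fin 3) ℂ →ₗ[ℂ] Module.End ℂ V where
  -- If `A = X + I • Y`, then `-(I • A) = Y - I • X`, whose skew part is `Y`.
  toFun A := ρ (skewPart A) + Complex.I • ρ (skewPart (-(Complex.I • A)))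
  map_add' A B := by
    simp only [smul_add, neg_add, map_add]
    module
  map_smul' c A := by
    have h1 : skewPart (c • A) = c.re • skewPart A + c.im • skewPart (Complex.I • A) := by
      rw [← map_smul, ← map_smul, ← map_add]
      congr 1
      conv_lhs => rw [← Complex.re_add_im c]
      rw [add_smul, mul_smul]
      rfl
    have h2 : skewPart (-(Complex.I • c • A)) =
        c.re • skewPart (-(Complex.I • A)) + c.im • skewPart A := by
      rw [← map_smul, ← map_smul, ← map_add]
      congr 1
      conv_lhs => rw [← Complex.re_add_im c]
      rw [add_smul, mul_smul, smul_add, smul_comm Complex.I (c.im : ℂ), I_smul_I_smul,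
        smul_comm Complex.I (c.re : ℂ), smul_neg, smul_neg, neg_add, neg_neg]
      rfl
    rw [h1, h2]
    conv_rhs => rw [← Complex.re_add_im c]
    simp only [map_add, map_neg, map_smul, RingHom.id_apply, smul_add, smul_neg,
      add_smul, mul_smul, I_smul_I_smul]
    simp only [← Complex.coe_smul]
    module

lemma Rep.complexify_add (ρ : Rep V) (X Y : su3) :
    ρ.complexify ((X : Matrix (Fin 3) (Fin 3) ℂ) +
      Complex.I • (Y : Matrix (Fin 3) (Fin 3) ℂ)) = ρ X + Complex.I • ρ Y := by
  change ρ (skewPart _) + Complex.I • ρ (skewPart _) = _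
  rw [skewPart_add, smul_add, I_smul_I_smul, neg_add, neg_neg, add_comm (-(Complex.I • _)),
    ← smul_neg]
  have : skewPart ((Y : Matrix (Fin 3) (Fin 3) ℂ) +
      Complex.I • -(X : Matrix (Fin 3) (Fin 3) ℂ)) = Y := skewPart_add Y (-X)
  rw [this]

lemma Rep.complexify_coe (ρ : Rep V) (X : su3) :
    ρ.complexify (X : Matrix (Fin 3) (Fin 3) ℂ) = ρ X := by
  simpa using ρ.complexify_add X 0

lemma Rep.complexify_lie (ρ : Rep V) {A B : Matrix (Fin 3) (Fin 3) ℂ} (hA : A.trace = 0)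
    (hB : B.trace = 0) : ρ.complexify ⁅A, B⁆ = ⁅ρ.complexify A, ρ.complexify B⁆ := by
  obtain ⟨X, Y, rfl⟩ := exists_eq_add_I_smul hA
  obtain ⟨Z, T, rfl⟩ := exists_eq_add_I_smul hB
  have : ⁅(X : Matrix (Fin 3) (Fin 3) ℂ) + Complex.I • (Y : Matrix (Fin 3) (Fin 3) ℂ),
      (Z : Matrix (Fin 3) (Fin 3) ℂ) + Complex.I • (T : Matrix (Fin 3) (Fin 3) ℂ)⁆ =
      ((⁅X, Z⁆ - ⁅Y, T⁆ : su3) : Matrix (Fin 3) (Fin 3) ℂ) +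
      Complex.I • ((⁅X, T⁆ + ⁅Y, Z⁆ : su3) : Matrix (Fin 3) (Fin 3) ℂ) := by
    push_cast [LieSubalgebra.coe_bracket]
    simp only [lie_add, add_lie, smul_lie, lie_smul]
    match_scalars <;> ring_nf <;> rw [Complex.I_sq]
  rw [this, ρ.complexify_add, ρ.complexify_add, ρ.complexify_add]
  simp only [map_add, map_sub, LieHom.map_lie, lie_add, add_lie, smul_lie, lie_smul]
  match_scalars <;> ring_nf <;> rw [Complex.I_sq]

/-- The matrices of the simple raising operators. -/
def raisingMatrix (i : Fin 2) : Matrix (Fin 3) (Fin 3) ℂ :=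
  Matrix.single i.castSucc i.succ 1

/-- The matrices of the simple lowering operators. -/
def loweringMatrix (i : Fin 2) : Matrix (Fin 3) (Fin 3) ℂ :=
  Matrix.single i.succ i.castSucc 1

/-- The simple coroots as diagonal matrices. -/
def corootMatrix (i : Fin 2) : Matrix (Fin 3) (Fin 3) ℂ :=
  Matrix.single i.castSucc i.castSucc 1 - Matrix.single i.succ i.succ 1

lemma trace_raisingMatrix (i : Fin 2) : (raisingMatrix i).trace = 0 := by
  fin_cases i <;> simp [raisingMatrix, Matrix.trace]

lemma trace_loweringMatrix (i : Fin 2) : (loweringMatrix i).trace = 0 := by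
  fin_cases i <;> simp [loweringMatrix, Matrix.trace]

lemma trace_corootMatrix (i : Fin 2) : (corootMatrix i).trace = 0 := by
  fin_cases i <;> simp [corootMatrix, Matrix.trace, Fin.sum_univ_three]

lemma lie_corootMatrix_corootMatrix (i j : Fin 2) : ⁅corootMatrix i, corootMatrix j⁆ = 0 := by
  fin_cases i <;> fin_cases j <;> ext k l <;> fin_cases k <;> fin_cases l <;>
    simp [corootMatrix, Ring.lie_def, Matrix.mul_apply, Matrix.single_apply]

lemma lie_corootMatrix_raisingMatrix (i j : Fin 2) :
    ⁅corootMatrix i, raisingMatrix j⁆ = cartanEntry i j • raisingMatrix j := by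
  fin_cases i <;> fin_cases j <;> ext k l <;> fin_cases k <;> fin_cases l <;>
    simp [corootMatrix, raisingMatrix, cartanEntry, Ring.lie_def, Matrix.mul_apply,
      Matrix.single_apply] <;> norm_num

lemma lie_corootMatrix_loweringMatrix (i j : Fin 2) :
    ⁅corootMatrix i, loweringMatrix j⁆ = -cartanEntry i j • loweringMatrix j := by
  fin_cases i <;> fin_cases j <;> ext k l <;> fin_cases k <;> fin_cases l <;>
    simp [corootMatrix, loweringMatrix, cartanEntry, Ring.lie_def, Matrix.mul_apply,
      Matrix.single_apply] <;> norm_num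

lemma lie_raisingMatrix_loweringMatrix (i j : Fin 2) :
    ⁅raisingMatrix i, loweringMatrix j⁆ = if i = j then corootMatrix i else 0 := by
  fin_cases i <;> fin_cases j <;> ext k l <;> fin_cases k <;> fin_cases l <;>
    simp [corootMatrix, raisingMatrix, loweringMatrix, Ring.lie_def, Matrix.mul_apply,
      Matrix.single_apply]

/-- The Chevalley generators of a representation. -/
noncomputable def Rep.chevalley (ρ : Rep V) : ChevalleySystem V where
  e i := ρ.complexify (raisingMatrix i)
  f i := ρ.complexify (loweringMatrix i)
  h i := ρ.complexify (corootMatrix i)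
  lie_h_h i j := by
    rw [← ρ.complexify_lie (trace_corootMatrix i) (trace_corootMatrix j),
      lie_corootMatrix_corootMatrix, map_zero]
  lie_h_e i j := by
    rw [← ρ.complexify_lie (trace_corootMatrix i) (trace_raisingMatrix j),
      lie_corootMatrix_raisingMatrix, map_smul]
  lie_h_f i j := by
    rw [← ρ.complexify_lie (trace_corootMatrix i) (trace_loweringMatrix j),
      lie_corootMatrix_loweringMatrix, map_smul]
  lie_e_f i j := by
    rw [← ρ.complexify_lie (trace_raisingMatrix i) (trace_loweringMatrix j),
      lie_raisingMatrix_loweringMatrix, apply_ite ρ.complexify, map_zero]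

/-- This expansion dictates the formula for `act`: the corner matrix units are commutators of simple
ones, and `diag(a, b, -a - b)` has coroot coefficients `a` and `a + b`. -/
lemma eq_sum_generators {A : Matrix (Fin 3) (Fin 3) ℂ} (hA : A.trace = 0) :
    A = A 0 1 • raisingMatrix 0 + A 1 2 • raisingMatrix 1 +
      A 0 2 • ⁅raisingMatrix 0, raisingMatrix 1⁆ + A 1 0 • loweringMatrix 0 +
      A 2 1 • loweringMatrix 1 + A 2 0 • ⁅loweringMatrix 1, loweringMatrix 0⁆ +
      A 0 0 • corootMatrix 0 + (A 0 0 + A 1 1) • corootMatrix 1 := by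
  rw [Matrix.trace_fin_three] at hA
  ext k l
  fin_cases k <;> fin_cases l <;>
    simp [corootMatrix, raisingMatrix, loweringMatrix, Ring.lie_def, Matrix.mul_apply,
      Matrix.single_apply]
  linear_combination hA

/-- The generators determine the representation; this gives the converse directions of
`Rep.isIrreducible_iff` and `Rep.isom_iff`. -/
lemma Rep.act_chevalley (ρ : Rep V) (X : su3) :
    ρ.chevalley.act (X : Matrix (Fin 3) (Fin 3) ℂ) = ρ X := by
  rw [← ρ.complexify_coe X]
  conv_rhs => rw [eq_sum_generators X.2.2]
  simp only [map_add, map_smul, ρ.complexify_lie (trace_raisingMatrix 0) (trace_raisingMatrix 1),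
    ρ.complexify_lie (trace_loweringMatrix 1) (trace_loweringMatrix 0)]
  rfl

lemma Rep.complexify_mem (ρ : Rep V) {U : Submodule ℂ V} (hU : ∀ X : su3, ∀ u ∈ U, ρ X u ∈ U)
    (A : Matrix (Fin 3) (Fin 3) ℂ) {u : V} (hu : u ∈ U) : ρ.complexify A u ∈ U :=
  add_mem (hU _ _ hu) (U.smul_mem _ (hU _ _ hu))

lemma Rep.isIrreducible_iff (ρ : Rep V) : ρ.IsIrreducible ↔ ρ.chevalley.IsIrreducible := by
  refine and_congr_right fun _ => forall_congr' fun U => imp_congr_left ⟨fun hU i u hu =>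
    ⟨ρ.complexify_mem hU _ hu, ρ.complexify_mem hU _ hu⟩, fun hU X u hu => ?_⟩
  rw [← ρ.act_chevalley]
  exact hU.act_mem _ hu

lemma Rep.isom_iff (ρ : Rep V) (σ : Rep W) : ρ.Isom σ ↔ ρ.chevalley.Isom σ.chevalley := by
  refine exists_congr fun T => ⟨fun hT i v => ?_, fun hT X v => ?_⟩
  · have h (A) : T (ρ.complexify A v) = σ.complexify A (T v) := by
      simp [Rep.complexify, hT]
    exact ⟨h _, h _⟩
  · rw [← ρ.act_chevalley, ← σ.act_chevalley]
    exact ChevalleySystem.map_act T hT _ v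

end SU3

/-! ### From Chevalley generators with Serre relations back to representations. -/

namespace SU3

namespace ChevalleySystem

variable {V : Type*} [AddCommGroup V] [Module ℂ V]

/-- Under the Serre relations, the action of traceless matrices is compatible with brackets. -/
theorem act_lie (C : ChevalleySystem V) (he : ∀ i j, i ≠ j → ⁅C.e i, ⁅C.e i, C.e j⁆⁆ = 0)
    (hf : ∀ i j, i ≠ j → ⁅C.f i, ⁅C.f i, C.f j⁆⁆ = 0) {A B : Matrix (Fin 3) (Fin 3) ℂ}
    (hA : A.trace = 0) (hB : B.trace = 0) : C.act ⁅A, B⁆ = ⁅C.act A, C.act B⁆ := by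
  have hA' : A 2 2 = -A 0 0 - A 1 1 := by
    rw [Matrix.trace_fin_three] at hA
    linear_combination hA
  have hB' : B 2 2 = -B 0 0 - B 1 1 := by
    rw [Matrix.trace_fin_three] at hB
    linear_combination hB
  have hh := C.lie_h_h
  have hhe := C.lie_h_e
  have hhf := C.lie_h_f
  have hef := C.lie_e_f
  simp only [Fin.forall_fin_two, Fin.isValue, ne_eq, not_true_eq_false, IsEmpty.forall_iff,
    zero_ne_one, one_ne_zero, not_false_eq_true, forall_const, true_and, and_true, cartanEntry,
    if_true, if_false, neg_neg, one_smul, neg_one_smul] at he hf hh hhe hhf hef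
  simp only [act_apply]
  generalize C.e 0 = e₀, C.e 1 = e₁, C.f 0 = f₀, C.f 1 = f₁, C.h 0 = h₀, C.h 1 = h₁ at *
  obtain ⟨e₀₀₁, e₁₁₀⟩ := he
  obtain ⟨f₀₀₁, f₁₁₀⟩ := hf
  obtain ⟨⟨-, h₀h₁⟩, h₁h₀, -⟩ := hh
  obtain ⟨⟨h₀e₀, h₀e₁⟩, h₁e₀, h₁e₁⟩ := hhe
  obtain ⟨⟨h₀f₀, h₀f₁⟩, h₁f₀, h₁f₁⟩ := hhf
  obtain ⟨⟨e₀f₀, e₀f₁⟩, e₁f₀, e₁f₁⟩ := hef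
  have flip {x y z : Module.End ℂ V} (h : ⁅x, y⁆ = z) : ⁅y, x⁆ = -z := by rw [← lie_skew, h]
  -- With names for the two non-simple root vectors, the Jacobi identity yields the complete bracket
  -- table; the claim then reduces to comparing coefficients.
  obtain ⟨e₂, he₂⟩ : ∃ x, ⁅e₀, e₁⁆ = x := ⟨_, rfl⟩
  obtain ⟨f₂, hf₂⟩ : ∃ x, ⁅f₁, f₀⁆ = x := ⟨_, rfl⟩
  have e₀e₂ : ⁅e₀, e₂⁆ = 0 := he₂ ▸ e₀₀₁
  have e₁e₂ : ⁅e₁, e₂⁆ = 0 := by rw [← he₂, ← lie_skew e₀ e₁, lie_neg, e₁₁₀, neg_zero]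
  have f₁f₂ : ⁅f₁, f₂⁆ = 0 := hf₂ ▸ f₁₁₀
  have f₀f₂ : ⁅f₀, f₂⁆ = 0 := by rw [← hf₂, ← lie_skew f₁ f₀, lie_neg, f₀₀₁, neg_zero]
  have h₀e₂ : ⁅h₀, e₂⁆ = e₂ := by
    rw [← he₂, leibniz_lie, h₀e₀, h₀e₁, smul_lie, lie_neg]
    module
  have h₁e₂ : ⁅h₁, e₂⁆ = e₂ := by
    rw [← he₂, leibniz_lie, h₁e₀, h₁e₁, lie_smul, neg_lie]
    module
  have h₀f₂ : ⁅h₀, f₂⁆ = -f₂ := by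
    rw [← hf₂, leibniz_lie, h₀f₀, h₀f₁, lie_smul]
    module
  have h₁f₂ : ⁅h₁, f₂⁆ = -f₂ := by
    rw [← hf₂, leibniz_lie, h₁f₀, h₁f₁, smul_lie]
    module
  have e₀f₂ : ⁅e₀, f₂⁆ = -f₁ := by
    rw [← hf₂, leibniz_lie, e₀f₁, e₀f₀, zero_lie, zero_add, flip h₀f₁]
  have e₁f₂ : ⁅e₁, f₂⁆ = f₀ := by
    rw [← hf₂, leibniz_lie, e₁f₁, e₁f₀, lie_zero, add_zero, h₁f₀]
  have e₂f₀ : ⁅e₂, f₀⁆ = -e₁ := by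
    rw [← he₂, lie_lie, e₁f₀, e₀f₀, lie_zero, zero_sub, flip h₀e₁, neg_neg]
  have e₂f₁ : ⁅e₂, f₁⁆ = e₀ := by
    rw [← he₂, lie_lie, e₁f₁, e₀f₁, lie_zero, sub_zero, flip h₁e₀, neg_neg]
  have e₂f₂ : ⁅e₂, f₂⁆ = h₀ + h₁ := by
    rw [← he₂, lie_lie, e₁f₂, e₀f₂, e₀f₀, lie_neg, sub_neg_eq_add, e₁f₁]
  simp only [lie_add, add_lie, smul_lie, lie_smul, lie_self, he₂, hf₂, e₀e₂, e₁e₂, f₁f₂, f₀f₂,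
    h₀e₂, h₁e₂, h₀f₂, h₁f₂, e₀f₂, e₁f₂, e₂f₀, e₂f₁, e₂f₂, h₀h₁, h₁h₀, h₀e₀, h₀e₁, h₁e₀, h₁e₁,
    h₀f₀, h₀f₁, h₁f₀, h₁f₁, e₀f₀, e₀f₁, e₁f₀, e₁f₁, flip he₂, flip hf₂, flip e₀e₂, flip e₁e₂,
    flip f₁f₂, flip f₀f₂, flip h₀e₂, flip h₁e₂, flip h₀f₂, flip h₁f₂, flip e₀f₂, flip e₁f₂,
    flip e₂f₀, flip e₂f₁, flip e₂f₂, flip h₀e₀, flip h₀e₁, flip h₁e₀, flip h₁e₁,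
    flip h₀f₀, flip h₀f₁, flip h₁f₀, flip h₁f₁, flip e₀f₀, flip e₀f₁, flip e₁f₀, flip e₁f₁]
  simp only [Ring.lie_def, Matrix.sub_apply, Matrix.mul_apply, Fin.sum_univ_three, hA', hB']
  module

end ChevalleySystem

variable {V : Type} [AddCommGroup V] [Module ℂ V]

/-- The representation attached to Chevalley generators satisfying the Serre relations. -/
noncomputable def ChevalleySystem.toRep (C : ChevalleySystem V)
    (he : ∀ i j, i ≠ j → ⁅C.e i, ⁅C.e i, C.e j⁆⁆ = 0)
    (hf : ∀ i j, i ≠ j → ⁅C.f i, ⁅C.f i, C.f j⁆⁆ = 0) : Rep V :=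
  { toFun := fun X => C.act (X : Matrix (Fin 3) (Fin 3) ℂ)
    map_add' := fun _ _ => map_add C.act _ _
    map_smul' := fun c _ => (C.act.restrictScalars ℝ).map_smul c _
    map_lie' := fun {X Y} => C.act_lie he hf X.2.2 Y.2.2 }

/-- `act` and the complexification of `toRep` are complex linear and agree on `su3`, hence on all
traceless matrices. -/
lemma ChevalleySystem.chevalley_toRep (C : ChevalleySystem V)
    (he : ∀ i j, i ≠ j → ⁅C.e i, ⁅C.e i, C.e j⁆⁆ = 0)
    (hf : ∀ i j, i ≠ j → ⁅C.f i, ⁅C.f i, C.f j⁆⁆ = 0) : (C.toRep he hf).chevalley = C := by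
  have key {A : Matrix (Fin 3) (Fin 3) ℂ} (hA : A.trace = 0) :
      (C.toRep he hf).complexify A = C.act A := by
    obtain ⟨X, Y, rfl⟩ := exists_eq_add_I_smul hA
    rw [Rep.complexify_add, map_add, map_smul]
    rfl
  have h1 : (C.toRep he hf).chevalley.e = C.e := by
    funext i
    refine (key (trace_raisingMatrix i)).trans ?_
    fin_cases i <;> simp [act_apply, raisingMatrix]
  have h2 : (C.toRep he hf).chevalley.f = C.f := by
    funext i
    refine (key (trace_loweringMatrix i)).trans ?_
    fin_cases i <;> simp [act_apply, loweringMatrix]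
  have h3 : (C.toRep he hf).chevalley.h = C.h := by
    funext i
    refine (key (trace_corootMatrix i)).trans ?_
    fin_cases i <;> simp [act_apply, corootMatrix]
  exact ChevalleySystem.ext h1 h2 h3

end SU3

/-! ### The Gelfand–Tsetlin model: operators and their relations. -/

namespace SU3

/-- The Gelfand–Tsetlin labels of the representation of highest weight `(p, q)`. -/
noncomputable def gtLabels (p q : ℕ) : Finset (ℤ × ℤ × ℤ) :=
  (Finset.Icc 0 (p : ℤ) ×ˢ Finset.Icc 0 (q : ℤ) ×ˢ Finset.Icc 0 ((p : ℤ) + q)).filter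
    fun x => x.2.2 ≤ x.1 + x.2.1

lemma mem_gtLabels {p q : ℕ} {a b j : ℤ} :
    (a, b, j) ∈ gtLabels p q ↔ 0 ≤ a ∧ a ≤ p ∧ 0 ≤ b ∧ b ≤ q ∧ 0 ≤ j ∧ j ≤ a + b := by
  simp only [gtLabels, Finset.mem_filter, Finset.mem_product, Finset.mem_Icc]
  omega

/-- The space with coordinates indexed by the Gelfand–Tsetlin labels. -/
def gtSpace (p q : ℕ) : Submodule ℂ (ℤ × ℤ × ℤ → ℂ) where
  carrier := {f | ∀ x ∉ gtLabels p q, f x = 0}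
  zero_mem' _ _ := rfl
  add_mem' hf hg x hx := by rw [Pi.add_apply, hf x hx, hg x hx, add_zero]
  smul_mem' c f hf x hx := by rw [Pi.smul_apply, hf x hx, smul_zero]

variable {p q : ℕ}

lemma gtSpace_apply_eq_zero (f : gtSpace p q) {a b j : ℤ}
    (h : ¬(0 ≤ a ∧ a ≤ p ∧ 0 ≤ b ∧ b ≤ q ∧ 0 ≤ j ∧ j ≤ a + b)) : f.1 (a, b, j) = 0 :=
  f.2 _ (mem_gtLabels.not.mpr h)

lemma gtSpace_ext {f g : gtSpace p q} (h : ∀ a b j : ℤ, 0 ≤ a → a ≤ p → 0 ≤ b → b ≤ q → 0 ≤ j →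
    j ≤ a + b → f.1 (a, b, j) = g.1 (a, b, j)) : f = g := by
  refine Subtype.ext (funext fun ⟨a, b, j⟩ => ?_)
  by_cases hx : 0 ≤ a ∧ a ≤ p ∧ 0 ≤ b ∧ b ≤ q ∧ 0 ≤ j ∧ j ≤ a + b
  · exact h a b j hx.1 hx.2.1 hx.2.2.1 hx.2.2.2.1 hx.2.2.2.2.1 hx.2.2.2.2.2
  · rw [gtSpace_apply_eq_zero f hx, gtSpace_apply_eq_zero g hx]

lemma mem_gtSpace_of_forall {g : ℤ × ℤ × ℤ → ℂ}
    (h : ∀ a b j : ℤ, g (a, b, j) ≠ 0 → 0 ≤ a ∧ a ≤ p ∧ 0 ≤ b ∧ b ≤ q ∧ 0 ≤ j ∧ j ≤ a + b) :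
    g ∈ gtSpace p q := by
  rintro ⟨a, b, j⟩ hx
  by_contra hne
  exact hx (mem_gtLabels.mpr (h a b j hne))

/-- First raising operator. -/
def gtE₀ (p q : ℕ) : Module.End ℂ (gtSpace p q) where
  toFun f := ⟨fun x => (x.2.2 + 1) * f.1 (x.1, x.2.1, x.2.2 + 1),
    -- The coefficient vanishes just where the shift would leave the set of labels, here at `j =
    -- -1`; the other operators are supported on labels for the same reason.
    mem_gtSpace_of_forall fun a b j h => by
      have h1 := not_imp_comm.mp (gtSpace_apply_eq_zero f) (right_ne_zero_of_mul h)
      dsimp only at h1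
      have h2 : j + 1 ≠ 0 := by exact_mod_cast left_ne_zero_of_mul h
      omega⟩
  map_add' f g := Subtype.ext <| funext fun x => mul_add _ _ _
  map_smul' c f := Subtype.ext <| funext fun x => mul_left_comm _ _ _

/-- First lowering operator. -/
def gtF₀ (p q : ℕ) : Module.End ℂ (gtSpace p q) where
  toFun f := ⟨fun x => (x.1 + x.2.1 - x.2.2 + 1) * f.1 (x.1, x.2.1, x.2.2 - 1),
    mem_gtSpace_of_forall fun a b j h => by
      have h1 := not_imp_comm.mp (gtSpace_apply_eq_zero f) (right_ne_zero_of_mul h)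
      dsimp only at h1
      have h2 : a + b - j + 1 ≠ 0 := by exact_mod_cast left_ne_zero_of_mul h
      omega⟩
  map_add' f g := Subtype.ext <| funext fun x => mul_add _ _ _
  map_smul' c f := Subtype.ext <| funext fun x => mul_left_comm _ _ _

/-- Multiplication of the coordinates by a function. -/
def gtDiagonal (p q : ℕ) (k : ℤ × ℤ × ℤ → ℂ) : Module.End ℂ (gtSpace p q) where
  toFun f := ⟨fun x => k x * f.1 x, fun x hx => mul_eq_zero_of_right _ (f.2 x hx)⟩
  map_add' _ _ := Subtype.ext <| funext fun _ => mul_add _ _ _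
  map_smul' _ _ := Subtype.ext <| funext fun _ => mul_left_comm _ _ _

/-- Second raising operator. -/
noncomputable def gtE₁ (p q : ℕ) : Module.End ℂ (gtSpace p q) where
  toFun f := ⟨fun x => (p - x.1 + 1) / (x.1 + x.2.1) * f.1 (x.1 - 1, x.2.1, x.2.2 - 1) +
      (x.2.1 + 1) * (x.2.1 + p + 2) / (x.1 + x.2.1 + 2) * (x.1 + x.2.1 + 1 - x.2.2) *
        f.1 (x.1, x.2.1 + 1, x.2.2),
    mem_gtSpace_of_forall fun a b j h => by
      contrapose! h
      have h1 : ((p : ℂ) - a + 1) / (a + b) * f.1 (a - 1, b, j - 1) = 0 := by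
        by_contra hne
        have h1 := not_imp_comm.mp (gtSpace_apply_eq_zero f) (right_ne_zero_of_mul hne)
        have h2 : (p : ℤ) - a + 1 ≠ 0 := by
          exact_mod_cast (div_ne_zero_iff.mp (left_ne_zero_of_mul hne)).1
        omega
      have h2 : ((b : ℂ) + 1) * (b + p + 2) / (a + b + 2) * (a + b + 1 - j) *
          f.1 (a, b + 1, j) = 0 := by
        by_contra hne
        have h1 := not_imp_comm.mp (gtSpace_apply_eq_zero f) (right_ne_zero_of_mul hne)
        have h2 := left_ne_zero_of_mul hne
        have h3 : a + b + 1 - j ≠ 0 := by exact_mod_cast right_ne_zero_of_mul h2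
        have h4 : b + 1 ≠ 0 := by
          exact_mod_cast left_ne_zero_of_mul (div_ne_zero_iff.mp (left_ne_zero_of_mul h2)).1
        omega
      simp only [h1, h2, add_zero]⟩
  map_add' f g := Subtype.ext <| funext fun x => by
    simp only [Submodule.coe_add, Pi.add_apply]
    ring
  map_smul' c f := Subtype.ext <| funext fun x => by
    simp only [Submodule.coe_smul, Pi.smul_apply, smul_eq_mul, RingHom.id_apply]
    ring

/-- Second lowering operator. -/
noncomputable def gtF₁ (p q : ℕ) : Module.End ℂ (gtSpace p q) where
  toFun f := ⟨fun x => (x.1 + 1) * (x.1 + q + 2) / (x.1 + x.2.1 + 2) * (x.2.2 + 1) *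
      f.1 (x.1 + 1, x.2.1, x.2.2 + 1) +
      (q - x.2.1 + 1) / (x.1 + x.2.1) * f.1 (x.1, x.2.1 - 1, x.2.2),
    mem_gtSpace_of_forall fun a b j h => by
      contrapose! h
      have h1 : ((q : ℂ) - b + 1) / (a + b) * f.1 (a, b - 1, j) = 0 := by
        by_contra hne
        have h1 := not_imp_comm.mp (gtSpace_apply_eq_zero f) (right_ne_zero_of_mul hne)
        have h2 : (q : ℤ) - b + 1 ≠ 0 := by
          exact_mod_cast (div_ne_zero_iff.mp (left_ne_zero_of_mul hne)).1
        omega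
      have h2 : ((a : ℂ) + 1) * (a + q + 2) / (a + b + 2) * (j + 1) *
          f.1 (a + 1, b, j + 1) = 0 := by
        by_contra hne
        have h1 := not_imp_comm.mp (gtSpace_apply_eq_zero f) (right_ne_zero_of_mul hne)
        have h2 := left_ne_zero_of_mul hne
        have h3 : j + 1 ≠ 0 := by exact_mod_cast right_ne_zero_of_mul h2
        have h4 : a + 1 ≠ 0 := by
          exact_mod_cast left_ne_zero_of_mul (div_ne_zero_iff.mp (left_ne_zero_of_mul h2)).1
        omega
      simp only [h1, h2, add_zero]⟩
  map_add' f g := Subtype.ext <| funext fun x => by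
    simp only [Submodule.coe_add, Pi.add_apply]
    ring
  map_smul' c f := Subtype.ext <| funext fun x => by
    simp only [Submodule.coe_smul, Pi.smul_apply, smul_eq_mul, RingHom.id_apply]
    ring

/-- Weights of the first coroot. -/
def gtWeight₀ (x : ℤ × ℤ × ℤ) : ℂ := x.1 + x.2.1 - 2 * x.2.2

/-- Weights of the second coroot. -/
def gtWeight₁ (p q : ℕ) (x : ℤ × ℤ × ℤ) : ℂ := x.2.2 + x.1 - 2 * x.2.1 + q - p

section Apply

variable (f : gtSpace p q) (a b j : ℤ)

lemma gtE₀_apply : (gtE₀ p q f).1 (a, b, j) = (j + 1) * f.1 (a, b, j + 1) := rfl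

lemma gtF₀_apply : (gtF₀ p q f).1 (a, b, j) = (a + b - j + 1) * f.1 (a, b, j - 1) := rfl

lemma gtDiagonal_apply (k : ℤ × ℤ × ℤ → ℂ) :
    (gtDiagonal p q k f).1 (a, b, j) = k (a, b, j) * f.1 (a, b, j) := rfl

lemma gtE₁_apply : (gtE₁ p q f).1 (a, b, j) = (p - a + 1) / (a + b) * f.1 (a - 1, b, j - 1) +
    (b + 1) * (b + p + 2) / (a + b + 2) * (a + b + 1 - j) * f.1 (a, b + 1, j) := rfl

lemma gtF₁_apply : (gtF₁ p q f).1 (a, b, j) =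
    (a + 1) * (a + q + 2) / (a + b + 2) * (j + 1) * f.1 (a + 1, b, j + 1) +
    (q - b + 1) / (a + b) * f.1 (a, b - 1, j) := rfl

end Apply

lemma lie_apply (x y : Module.End ℂ (gtSpace p q)) (f : gtSpace p q) (c : ℤ × ℤ × ℤ) :
    (⁅x, y⁆ f).1 c = (x (y f)).1 c - (y (x f)).1 c := rfl

lemma lie_gtE₀_gtF₀ : ⁅gtE₀ p q, gtF₀ p q⁆ = gtDiagonal p q gtWeight₀ := by
  refine LinearMap.ext fun f => gtSpace_ext fun a b j ha ha' hb hb' hj hj' => ?_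
  simp only [lie_apply, gtE₀_apply, gtF₀_apply, gtDiagonal_apply, gtWeight₀]
  push_cast
  simp only [sub_add_cancel, add_sub_cancel_right]
  ring

lemma lie_gtE₀_gtF₁ : ⁅gtE₀ p q, gtF₁ p q⁆ = (0 : Module.End ℂ (gtSpace p q)) := by
  refine LinearMap.ext fun f => gtSpace_ext fun a b j ha ha' hb hb' hj hj' => ?_
  simp only [lie_apply, gtE₀_apply, gtF₁_apply]
  push_cast
  simp only [LinearMap.zero_apply, Submodule.coe_zero, Pi.zero_apply]
  ring

lemma lie_gtE₁_gtF₀ : ⁅gtE₁ p q, gtF₀ p q⁆ = (0 : Module.End ℂ (gtSpace p q)) := by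
  refine LinearMap.ext fun f => gtSpace_ext fun a b j ha ha' hb hb' hj hj' => ?_
  simp only [lie_apply, gtE₁_apply, gtF₀_apply]
  push_cast
  simp only [LinearMap.zero_apply, Submodule.coe_zero, Pi.zero_apply]
  ring

lemma lie_gtE₁_gtF₁ : ⁅gtE₁ p q, gtF₁ p q⁆ = gtDiagonal p q (gtWeight₁ p q) := by
  refine LinearMap.ext fun f => gtSpace_ext fun a b j ha ha' hb hb' hj hj' => ?_
  simp only [lie_apply, gtE₁_apply, gtF₁_apply, gtDiagonal_apply, gtWeight₁]
  push_cast
  simp only [sub_add_cancel, add_sub_cancel_right]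
  have h1 : (a : ℂ) + b + 1 ≠ 0 := by exact_mod_cast (by omega : a + b + 1 ≠ 0)
  have h2 : (a : ℂ) + b + 2 ≠ 0 := by exact_mod_cast (by omega : a + b + 2 ≠ 0)
  have e1 : (a : ℂ) - 1 + b + 2 = a + b + 1 := by ring
  have e2 : (a : ℂ) + (b + 1) = a + b + 1 := by ring
  have e3 : (a : ℂ) + 1 + b = a + b + 1 := by ring
  have e4 : (a : ℂ) + (b - 1) + 2 = a + b + 1 := by ring
  -- At the only label with `a + b = 0`, quotients by `a + b` take the default value `0`, and the
  -- remaining terms give the weight `q - p`.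
  by_cases hab : a + b = 0
  · obtain ⟨rfl, rfl, rfl⟩ : a = 0 ∧ b = 0 ∧ j = 0 := by omega
    rw [gtSpace_apply_eq_zero f (by omega : ¬ (0 ≤ (0 : ℤ) - 1 ∧ _))]
    simp
    ring
  have h0 : (a : ℂ) + b ≠ 0 := by exact_mod_cast hab
  simp only [e1, e2, e3, e4]
  field_simp
  ring

/-- The raising operator of the highest root. -/
noncomputable def gtE₂ (p q : ℕ) : Module.End ℂ (gtSpace p q) := ⁅gtE₀ p q, gtE₁ p q⁆

lemma gtE₂_apply (f : gtSpace p q) (a b j : ℤ) : (gtE₂ p q f).1 (a, b, j) =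
    (p - a + 1) / (a + b) * f.1 (a - 1, b, j) -
    (b + 1) * (b + p + 2) / (a + b + 2) * (j + 1) * f.1 (a, b + 1, j + 1) := by
  simp only [gtE₂, lie_apply, gtE₀_apply, gtE₁_apply]
  push_cast
  simp only [sub_add_cancel, add_sub_cancel_right]
  ring

/-- The lowering operator of the highest root. -/
noncomputable def gtF₂ (p q : ℕ) : Module.End ℂ (gtSpace p q) := ⁅gtF₁ p q, gtF₀ p q⁆

lemma gtF₂_apply (f : gtSpace p q) (a b j : ℤ) : (gtF₂ p q f).1 (a, b, j) =
    (a + 1) * (a + q + 2) / (a + b + 2) * (a + b - j + 1) * f.1 (a + 1, b, j) -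
    (q - b + 1) / (a + b) * f.1 (a, b - 1, j - 1) := by
  simp only [gtF₂, lie_apply, gtF₀_apply, gtF₁_apply]
  push_cast
  simp only [sub_add_cancel, add_sub_cancel_right]
  ring

lemma lie_gtE₀_gtE₂ : ⁅gtE₀ p q, gtE₂ p q⁆ = (0 : Module.End ℂ (gtSpace p q)) := by
  refine LinearMap.ext fun f => gtSpace_ext fun a b j ha ha' hb hb' hj hj' => ?_
  simp only [lie_apply, gtE₀_apply, gtE₂_apply]
  push_cast
  simp only [LinearMap.zero_apply, Submodule.coe_zero, Pi.zero_apply]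
  ring

lemma lie_gtF₀_gtF₂ : ⁅gtF₀ p q, gtF₂ p q⁆ = (0 : Module.End ℂ (gtSpace p q)) := by
  refine LinearMap.ext fun f => gtSpace_ext fun a b j ha ha' hb hb' hj hj' => ?_
  simp only [lie_apply, gtF₀_apply, gtF₂_apply]
  push_cast
  simp only [LinearMap.zero_apply, Submodule.coe_zero, Pi.zero_apply]
  ring

lemma lie_gtE₁_gtE₂ : ⁅gtE₁ p q, gtE₂ p q⁆ = (0 : Module.End ℂ (gtSpace p q)) := by
  refine LinearMap.ext fun f => gtSpace_ext fun a b j ha ha' hb hb' hj hj' => ?_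
  simp only [lie_apply, gtE₁_apply, gtE₂_apply]
  push_cast
  simp only [sub_add_cancel, add_sub_cancel_right, LinearMap.zero_apply, Submodule.coe_zero,
    Pi.zero_apply]
  have h1 : (a : ℂ) + b + 1 ≠ 0 := by exact_mod_cast (by omega : a + b + 1 ≠ 0)
  have h2 : (a : ℂ) + b + 2 ≠ 0 := by exact_mod_cast (by omega : a + b + 2 ≠ 0)
  have e1 : (a : ℂ) - 1 + b + 2 = a + b + 1 := by ring
  have e2 : (a : ℂ) + (b + 1) = a + b + 1 := by ring
  by_cases hab : a + b = 0
  · obtain ⟨rfl, rfl, rfl⟩ : a = 0 ∧ b = 0 ∧ j = 0 := by omega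
    simp [gtSpace_apply_eq_zero f]
  have h0 : (a : ℂ) + b ≠ 0 := by exact_mod_cast hab
  simp only [e1, e2]
  field_simp
  ring

lemma lie_gtF₁_gtF₂ : ⁅gtF₁ p q, gtF₂ p q⁆ = (0 : Module.End ℂ (gtSpace p q)) := by
  refine LinearMap.ext fun f => gtSpace_ext fun a b j ha ha' hb hb' hj hj' => ?_
  simp only [lie_apply, gtF₁_apply, gtF₂_apply]
  push_cast
  simp only [sub_add_cancel, add_sub_cancel_right, LinearMap.zero_apply, Submodule.coe_zero,
    Pi.zero_apply]
  have h1 : (a : ℂ) + b + 1 ≠ 0 := by exact_mod_cast (by omega : a + b + 1 ≠ 0)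
  have h2 : (a : ℂ) + b + 2 ≠ 0 := by exact_mod_cast (by omega : a + b + 2 ≠ 0)
  have e3 : (a : ℂ) + 1 + b = a + b + 1 := by ring
  have e4 : (a : ℂ) + (b - 1) + 2 = a + b + 1 := by ring
  by_cases hab : a + b = 0
  · obtain ⟨rfl, rfl, rfl⟩ : a = 0 ∧ b = 0 ∧ j = 0 := by omega
    simp [gtSpace_apply_eq_zero f]
  have h0 : (a : ℂ) + b ≠ 0 := by exact_mod_cast hab
  simp only [e3, e4]
  field_simp
  ring

end SU3

/-! ### Dimension and irreducibility of the model. -/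

namespace SU3

/-- The Chevalley generators of the representation of highest weight `(p, q)`. -/
noncomputable def gtSystem (p q : ℕ) : ChevalleySystem (gtSpace p q) where
  e := ![gtE₀ p q, gtE₁ p q]
  f := ![gtF₀ p q, gtF₁ p q]
  h := ![gtDiagonal p q gtWeight₀, gtDiagonal p q (gtWeight₁ p q)]
  lie_h_h i j := by
    refine LinearMap.ext fun f => gtSpace_ext fun a b j ha ha' hb hb' hj hj' => ?_
    fin_cases i <;> rename_i i <;> fin_cases i <;>
      simp [gtDiagonal_apply] <;> ring
  lie_h_e i j := by
    refine LinearMap.ext fun f => gtSpace_ext fun a b j ha ha' hb hb' hj hj' => ?_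
    fin_cases i <;> rename_i i <;> fin_cases i <;>
      simp [gtDiagonal_apply, gtE₀_apply, gtE₁_apply, gtWeight₀, gtWeight₁,
        cartanEntry] <;> ring
  lie_h_f i j := by
    refine LinearMap.ext fun f => gtSpace_ext fun a b j ha ha' hb hb' hj hj' => ?_
    fin_cases i <;> rename_i i <;> fin_cases i <;>
      simp [gtDiagonal_apply, gtF₀_apply, gtF₁_apply, gtWeight₀, gtWeight₁,
        cartanEntry] <;> ring
  lie_e_f i j := by
    fin_cases i <;> fin_cases j
    · exact lie_gtE₀_gtF₀
    · exact lie_gtE₀_gtF₁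
    · exact lie_gtE₁_gtF₀
    · exact lie_gtE₁_gtF₁

variable {p q : ℕ}

lemma gtSystem_serre_e (i j : Fin 2) (hij : i ≠ j) :
    ⁅(gtSystem p q).e i, ⁅(gtSystem p q).e i, (gtSystem p q).e j⁆⁆ = 0 := by
  fin_cases i <;> fin_cases j
  · exact absurd rfl hij
  · exact lie_gtE₀_gtE₂
  · change ⁅gtE₁ p q, ⁅gtE₁ p q, gtE₀ p q⁆⁆ = 0
    rw [← lie_skew (gtE₁ p q) (gtE₀ p q), lie_neg]
    exact neg_eq_zero.mpr lie_gtE₁_gtE₂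
  · exact absurd rfl hij

lemma gtSystem_serre_f (i j : Fin 2) (hij : i ≠ j) :
    ⁅(gtSystem p q).f i, ⁅(gtSystem p q).f i, (gtSystem p q).f j⁆⁆ = 0 := by
  fin_cases i <;> fin_cases j
  · exact absurd rfl hij
  · change ⁅gtF₀ p q, ⁅gtF₀ p q, gtF₁ p q⁆⁆ = 0
    rw [← lie_skew (gtF₀ p q) (gtF₁ p q), lie_neg]
    exact neg_eq_zero.mpr lie_gtF₀_gtF₂
  · exact lie_gtF₁_gtF₂
  · exact absurd rfl hij

/-- Restriction of coordinates to the labels. -/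
noncomputable def gtCoordinates (p q : ℕ) : gtSpace p q ≃ₗ[ℂ] (gtLabels p q → ℂ) where
  toFun f x := f.1 x
  map_add' _ _ := rfl
  map_smul' _ _ := rfl
  invFun g := ⟨fun x => if hx : x ∈ gtLabels p q then g ⟨x, hx⟩ else 0, fun _ hx => dif_neg hx⟩
  left_inv f := Subtype.ext <| funext fun x => by
    by_cases hx : x ∈ gtLabels p q
    · simp [hx]
    · simp [hx, f.2 x hx]
  right_inv g := funext fun x => by simp

/-- The Gelfand–Tsetlin basis, extended by zero to all integer labels. -/
noncomputable def gtVector (p q : ℕ) (x : ℤ × ℤ × ℤ) : gtSpace p q :=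
  ⟨fun y => if y = x ∧ x ∈ gtLabels p q then 1 else 0, fun y hy => if_neg (by aesop)⟩

lemma gtVector_apply {x : ℤ × ℤ × ℤ} (hx : x ∈ gtLabels p q) (y : ℤ × ℤ × ℤ) :
    (gtVector p q x).1 y = if y = x then 1 else 0 := by
  simp [gtVector, hx]

lemma span_gtVector {U : Submodule ℂ (gtSpace p q)}
    (hU : ∀ x ∈ gtLabels p q, gtVector p q x ∈ U) : U = ⊤ := by
  refine eq_top_iff.mpr fun f _ => ?_
  have : f = ∑ x ∈ gtLabels p q, f.1 x • gtVector p q x := by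
    refine gtSpace_ext fun a b j ha ha' hb hb' hj hj' => ?_
    have hx : (a, b, j) ∈ gtLabels p q := mem_gtLabels.mpr ⟨ha, ha', hb, hb', hj, hj'⟩
    rw [AddSubmonoidClass.coe_finsetSum, Finset.sum_apply, Finset.sum_eq_single_of_mem _ hx]
    · simp [gtVector_apply hx]
    · intro y hy hne
      simp [gtVector_apply hy, hne.symm]
  rw [this]
  exact sum_mem fun x hx => U.smul_mem _ (hU x hx)

instance : FiniteDimensional ℂ (gtSpace p q) := (gtCoordinates p q).symm.finiteDimensional

/-- For fixed `(a, b)` the index `j` takes `a + b + 1` values; these are summed over the rectangle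
of `(a, b)`. -/
lemma card_gtLabels (p q : ℕ) : 2 * (gtLabels p q).card = (p + 1) * (q + 1) * (p + q + 2) := by
  have hrange (n : ℕ) (g : ℤ → ℕ) :
      ∑ x ∈ Finset.Icc 0 (n : ℤ), g x = ∑ x ∈ Finset.range (n + 1), g x := by
    refine Finset.sum_nbij' Int.toNat (fun x => (x : ℤ)) ?_ ?_ ?_ ?_ ?_ <;>
      simp only [Finset.mem_Icc, Finset.mem_range]
    · omega
    · omega
    · omega
    · omega
    · intro x hx
      rw [Int.toNat_of_nonneg hx.1]
  have h1 : (gtLabels p q).card =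
      ∑ a ∈ Finset.range (p + 1), ∑ b ∈ Finset.range (q + 1), (a + b + 1) := by
    rw [gtLabels, Finset.card_filter, Finset.sum_product, hrange]
    refine Finset.sum_congr rfl fun a ha => ?_
    rw [Finset.sum_product, hrange]
    refine Finset.sum_congr rfl fun b hb => ?_
    rw [Finset.mem_range] at ha hb
    rw [← Finset.card_filter]
    have : (Finset.Icc (0 : ℤ) (p + q)).filter (fun j => j ≤ (a : ℤ) + b) =
        Finset.Icc 0 ((a : ℤ) + b) := by
      ext j
      simp only [Finset.mem_filter, Finset.mem_Icc]
      omega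
    simp only [this, Int.card_Icc]
    omega
  have h2 (a n : ℕ) : 2 * ∑ b ∈ Finset.range (n + 1), (a + b + 1) = (n + 1) * (2 * a + n + 2) := by
    induction n with
    | zero => simp; ring
    | succ n ih => rw [Finset.sum_range_succ, mul_add, ih]; ring
  have h3 (n : ℕ) : ∑ a ∈ Finset.range (n + 1), (q + 1) * (2 * a + q + 2) =
      (n + 1) * (q + 1) * (n + q + 2) := by
    induction n with
    | zero => simp
    | succ n ih => rw [Finset.sum_range_succ, ih]; ring
  rw [h1, Finset.mul_sum, ← h3]
  exact Finset.sum_congr rfl fun a _ => h2 a q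

lemma finrank_gtSpace (p q : ℕ) :
    2 * Module.finrank ℂ (gtSpace p q) = (p + 1) * (q + 1) * (p + q + 2) := by
  rw [(gtCoordinates p q).finrank_eq, Module.finrank_fintype_fun_eq_card, Fintype.card_coe,
    card_gtLabels]

lemma top_mem_gtLabels : ((p : ℤ), (0 : ℤ), (0 : ℤ)) ∈ gtLabels p q :=
  mem_gtLabels.mpr (by omega)

/-- A vector killed by the raising operators is a multiple of the top basis vector. -/
lemma eq_smul_of_e_eq_zero {f : gtSpace p q} (h₀ : gtE₀ p q f = 0) (h₁ : gtE₁ p q f = 0) :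
    f = f.1 (p, 0, 0) • gtVector p q (p, 0, 0) := by
  -- The first raising operator forces the coordinates with `j ≥ 1` to vanish. The second, read at
  -- `(a + 1, b, 1)` and at `(a, b - 1, 0)`, then leaves one surviving term each and kills those
  -- with `a < p` and with `b ≥ 1`.
  have hj {a b j : ℤ} (hj : 1 ≤ j) : f.1 (a, b, j) = 0 := by
    have h := gtE₀_apply f a b (j - 1)
    rw [h₀, sub_add_cancel] at h
    push_cast at h
    simpa [show (j : ℂ) ≠ 0 by exact_mod_cast (by omega : j ≠ 0)] using h
  have ha {a b : ℤ} (ha : 0 ≤ a) (ha' : a < p) (hb : 0 ≤ b) : f.1 (a, b, 0) = 0 := by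
    have h := gtE₁_apply f (a + 1) b 1
    rw [h₁, hj le_rfl, add_sub_cancel_right, sub_self] at h
    push_cast at h
    have h1 : (p : ℂ) - (a + 1) + 1 ≠ 0 := by
      exact_mod_cast (by omega : (p : ℤ) - (a + 1) + 1 ≠ 0)
    have h2 : (a : ℂ) + 1 + b ≠ 0 := by exact_mod_cast (by omega : a + 1 + b ≠ 0)
    simpa [h1, h2] using h
  have hb {a b : ℤ} (ha : 0 ≤ a) (hb : 1 ≤ b) : f.1 (a, b, 0) = 0 := by
    have h := gtE₁_apply f a (b - 1) 0
    rw [h₁, gtSpace_apply_eq_zero f (a := a - 1) (j := 0 - 1) (by omega), sub_add_cancel] at h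
    push_cast at h
    have h1 : (b : ℂ) - 1 + p + 2 ≠ 0 := by exact_mod_cast (by omega : b - 1 + p + 2 ≠ 0)
    have h2 : (a : ℂ) + (b - 1) + 2 ≠ 0 := by exact_mod_cast (by omega : a + (b - 1) + 2 ≠ 0)
    have h3 : (a : ℂ) + (b - 1) + 1 ≠ 0 := by exact_mod_cast (by omega : a + (b - 1) + 1 ≠ 0)
    have h4 : (b : ℂ) ≠ 0 := by exact_mod_cast (by omega : b ≠ 0)
    simpa [h1, h2, h3, h4] using h
  refine gtSpace_ext fun a b j h1 h2 h3 h4 h5 h6 => ?_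
  rw [Submodule.coe_smul, Pi.smul_apply, gtVector_apply top_mem_gtLabels]
  split_ifs with hx
  · obtain ⟨rfl, rfl, rfl⟩ : a = p ∧ b = 0 ∧ j = 0 := by simpa using hx
    simp
  · rw [smul_zero]
    simp only [Prod.mk.injEq] at hx
    rcases h5.lt_or_eq with h | rfl
    · exact hj h
    · rcases h3.lt_or_eq with h | rfl
      · exact hb h1 h
      · exact ha h1 (by omega) le_rfl

lemma isHighestWeightVector_gtVector (p q : ℕ) :
    (gtSystem p q).IsHighestWeightVector ![(p : ℂ), (q : ℂ)] (gtVector p q (p, 0, 0)) where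
  ne_zero h := by
    have := gtVector_apply (p := p) (q := q) top_mem_gtLabels (p, 0, 0)
    rw [h] at this
    simp at this
  e_apply i := by
    refine gtSpace_ext fun a b j h1 h2 h3 h4 h5 h6 => ?_
    fin_cases i
    · have : ¬ (j + 1 = 0) := by omega
      simp [gtSystem, gtE₀_apply, gtVector_apply top_mem_gtLabels, this]
    · have h7 : ¬ (b + 1 = 0) := by omega
      have h8 : ¬ (a - 1 = p) := by omega
      simp [gtSystem, gtE₁_apply, gtVector_apply top_mem_gtLabels, h7, h8]
  h_apply i := by
    refine gtSpace_ext fun a b j h1 h2 h3 h4 h5 h6 => ?_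
    fin_cases i <;>
      simp only [gtSystem, Fin.zero_eta, Fin.mk_one, Matrix.cons_val_zero, Matrix.cons_val_one,
        gtDiagonal_apply, Submodule.coe_smul, Pi.smul_apply, smul_eq_mul,
        gtVector_apply top_mem_gtLabels, mul_ite, mul_one, mul_zero, gtWeight₀, gtWeight₁] <;>
      split_ifs with hx <;> try rfl
    all_goals
      obtain ⟨rfl, rfl, rfl⟩ : a = p ∧ b = 0 ∧ j = 0 := by simpa using hx
      simp

lemma gtF₀_gtVector {a b j : ℤ} (hx : (a, b, j) ∈ gtLabels p q)
    (hx' : (a, b, j + 1) ∈ gtLabels p q) :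
    gtF₀ p q (gtVector p q (a, b, j)) = ((a : ℂ) + b - j) • gtVector p q (a, b, j + 1) := by
  refine gtSpace_ext fun a' b' j' _ _ _ _ _ _ => ?_
  simp only [gtF₀_apply, gtVector_apply hx, gtVector_apply hx', Submodule.coe_smul, Pi.smul_apply,
    smul_eq_mul, Prod.mk.injEq, sub_eq_iff_eq_add]
  split_ifs with h
  · obtain ⟨rfl, rfl, rfl⟩ := h
    push_cast
    ring
  · simp

lemma gtF₁_gtVector_zero {a b : ℤ} (hx : (a, b, 0) ∈ gtLabels p q)
    (hx' : (a, b + 1, 0) ∈ gtLabels p q) :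
    gtF₁ p q (gtVector p q (a, b, 0)) =
      (((q : ℂ) - b) / (a + b + 1)) • gtVector p q (a, b + 1, 0) := by
  refine gtSpace_ext fun a' b' j' _ _ _ _ hj _ => ?_
  have : ¬ (j' + 1 = 0) := by omega
  simp only [gtF₁_apply, gtVector_apply hx, gtVector_apply hx', Submodule.coe_smul, Pi.smul_apply,
    smul_eq_mul, Prod.mk.injEq, sub_eq_iff_eq_add, this, and_false, if_false, mul_zero, zero_add]
  split_ifs with h
  · obtain ⟨rfl, rfl, rfl⟩ := h
    push_cast
    ring
  · simp

lemma gtF₁_gtVector_succ {a b j : ℤ} (hx : (a + 1, b, j + 1) ∈ gtLabels p q)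
    (hx' : (a, b, j) ∈ gtLabels p q) :
    gtF₁ p q (gtVector p q (a + 1, b, j + 1)) =
      (((a : ℂ) + 1) * (a + q + 2) / (a + b + 2) * (j + 1)) • gtVector p q (a, b, j) +
      (((q : ℂ) - b) / (a + b + 2)) • gtVector p q (a + 1, b + 1, j + 1) := by
  refine gtSpace_ext fun a' b' j' h1 h2 h3 h4 h5 h6 => ?_
  simp only [gtF₁_apply, Submodule.coe_add, Pi.add_apply, gtVector_apply hx, gtVector_apply hx',
    Submodule.coe_smul, Pi.smul_apply, smul_eq_mul, Prod.mk.injEq, sub_eq_iff_eq_add,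
    add_left_inj]
  congr 1
  · split_ifs with h
    · obtain ⟨rfl, rfl, rfl⟩ := h
      rfl
    · simp
  · by_cases h : a' = a + 1 ∧ b' = b + 1 ∧ j' = j + 1
    · obtain ⟨rfl, rfl, rfl⟩ := h
      rw [gtVector_apply (mem_gtLabels.mpr ⟨h1, h2, h3, h4, h5, h6⟩)]
      push_cast
      simp
      ring
    · simp [gtVector, h]

/-- From the top vector, `gtF₁` reaches all `(p, b, 0)` and `gtF₀` all `(p, b, j)`. Smaller `a`
follow by descending induction: `gtF₁` sends `(a + 1, b, j + 1)` to a nonzero multiple of `(a, b,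
j)` plus a term whose first label is still `a + 1`. -/
lemma eq_top_of_gtVector_mem {U : Submodule ℂ (gtSpace p q)} (hU : (gtSystem p q).IsInvariant U)
    (htop : gtVector p q (p, 0, 0) ∈ U) : U = ⊤ := by
  have hF₀ : ∀ u ∈ U, gtF₀ p q u ∈ U := fun u hu => (hU 0 u hu).2
  have hF₁ : ∀ u ∈ U, gtF₁ p q u ∈ U := fun u hu => (hU 1 u hu).2
  have hzero (b : ℕ) (hb : b ≤ q) : gtVector p q (p, b, 0) ∈ U := by
    induction b with
    | zero => exact htop
    | succ b ih =>
      have h := hF₁ _ (ih (by omega))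
      rw [gtF₁_gtVector_zero (mem_gtLabels.mpr (by omega)) (mem_gtLabels.mpr (by omega))] at h
      have h1 : (q : ℂ) - b ≠ 0 := sub_ne_zero.mpr (by exact_mod_cast (by omega : q ≠ b))
      have h2 : (p : ℂ) + b + 1 ≠ 0 := by exact_mod_cast (by omega : p + b + 1 ≠ 0)
      exact_mod_cast (Submodule.smul_mem_iff _ (by push_cast; exact div_ne_zero h1 h2)).mp h
  have hlast (b j : ℕ) (hb : b ≤ q) (hj : j ≤ p + b) : gtVector p q (p, b, j) ∈ U := by
    induction j with
    | zero => exact hzero b hb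
    | succ j ih =>
      have h := hF₀ _ (ih (by omega))
      rw [gtF₀_gtVector (mem_gtLabels.mpr (by omega)) (mem_gtLabels.mpr (by omega))] at h
      have h1 : (p : ℂ) + b - j ≠ 0 := sub_ne_zero.mpr (by exact_mod_cast (by omega : p + b ≠ j))
      exact_mod_cast (Submodule.smul_mem_iff _ (by push_cast; exact h1)).mp h
  have hall (k a b j : ℕ) (ha : a + k = p) (hb : b ≤ q) (hj : j ≤ a + b) :
      gtVector p q (a, b, j) ∈ U := by
    induction k generalizing a b j with
    | zero =>
      obtain rfl : a = p := by omega
      exact hlast b j hb hj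
    | succ k ih =>
      have h := hF₁ _ (ih (a + 1) b (j + 1) (by omega) hb (by omega))
      push_cast at h
      rw [gtF₁_gtVector_succ (mem_gtLabels.mpr (by omega)) (mem_gtLabels.mpr (by omega))] at h
      have h' : (((q : ℂ) - b) / (a + b + 2)) •
          gtVector p q ((a : ℤ) + 1, (b : ℤ) + 1, (j : ℤ) + 1) ∈ U := by
        -- For `b = q` the second term has no valid label, but its coefficient `q - b` is zero.
        rcases hb.lt_or_eq with hb | rfl
        · exact U.smul_mem _ (by exact_mod_cast ih (a + 1) (b + 1) (j + 1) (by omega) hb (by omega))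
        · simp
      push_cast at h
      rw [Submodule.add_mem_iff_left _ h'] at h
      refine (Submodule.smul_mem_iff _ ?_).mp h
      refine mul_ne_zero (div_ne_zero (mul_ne_zero ?_ ?_) ?_) ?_ <;> norm_cast
  refine span_gtVector fun ⟨a, b, j⟩ hx => ?_
  obtain ⟨h1, h2, h3, h4, h5, h6⟩ := mem_gtLabels.mp hx
  lift a to ℕ using h1
  lift b to ℕ using h3
  lift j to ℕ using h5
  exact hall (p - a) a b j (by omega) (by omega) (by omega)

/-- The restriction of a system to an invariant subspace. -/
def ChevalleySystem.restrict {V : Type*} [AddCommGroup V] [Module ℂ V] (C : ChevalleySystem V)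
    {U : Submodule ℂ V} (hU : C.IsInvariant U) : ChevalleySystem U where
  e i := (C.e i).restrict fun u hu => (hU i u hu).1
  f i := (C.f i).restrict fun u hu => (hU i u hu).2
  h i := (C.h i).restrict fun u hu => by
    rw [h_apply_eq]
    exact sub_mem (hU i _ (hU i u hu).2).1 (hU i _ (hU i u hu).1).2
  lie_h_h i j := LinearMap.ext fun u => Subtype.ext (LinearMap.congr_fun (C.lie_h_h i j) u)
  lie_h_e i j := LinearMap.ext fun u => Subtype.ext (LinearMap.congr_fun (C.lie_h_e i j) u)
  lie_h_f i j := LinearMap.ext fun u => Subtype.ext (LinearMap.congr_fun (C.lie_h_f i j) u)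
  lie_e_f i j := LinearMap.ext fun u => Subtype.ext <| by
    have := LinearMap.congr_fun (C.lie_e_f i j) u
    split_ifs at this ⊢ <;> exact this

/-- A nonzero invariant subspace contains a highest weight vector of its own, which must be a
multiple of the top vector, and that vector generates the whole space. -/
theorem gtSystem_isIrreducible (p q : ℕ) : (gtSystem p q).IsIrreducible := by
  refine ⟨⟨_, 0, (isHighestWeightVector_gtVector p q).ne_zero⟩, fun U hU => ?_⟩
  refine or_iff_not_imp_left.mpr fun hne => eq_top_of_gtVector_mem hU ?_
  have := Submodule.nontrivial_iff_ne_bot.mpr hne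
  obtain ⟨μ, ⟨u, huU⟩, hu⟩ := ((gtSystem p q).restrict hU).exists_isHighestWeightVector
  have h := eq_smul_of_e_eq_zero (f := u) (congrArg Subtype.val (hu.e_apply 0))
    (congrArg Subtype.val (hu.e_apply 1))
  have hne : u.1 (p, 0, 0) ≠ 0 := fun h0 => hu.ne_zero (Subtype.ext (by
    rw [h0, zero_smul] at h
    exact h))
  rw [h] at huU
  exact (Submodule.smul_mem_iff _ hne).mp huU

theorem gtSystem_highestWeight_unique {μ : Fin 2 → ℂ} {f : gtSpace p q}
    (hf : (gtSystem p q).IsHighestWeightVector μ f) : μ = ![(p : ℂ), (q : ℂ)] := by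
  have h := eq_smul_of_e_eq_zero (hf.e_apply 0) (hf.e_apply 1)
  funext i
  have h1 : (gtSystem p q).h i f = ![(p : ℂ), (q : ℂ)] i • f := by
    rw [h, map_smul, (isHighestWeightVector_gtVector p q).h_apply, smul_comm]
  rw [hf.h_apply] at h1
  exact smul_left_injective ℂ hf.ne_zero h1

end SU3

/-! ### Classification of irreducible representations by highest weight. -/

namespace SU3

namespace ChevalleySystem

variable {V W X : Type*} [AddCommGroup V] [Module ℂ V] [AddCommGroup W] [Module ℂ W]
  [AddCommGroup X] [Module ℂ X]

lemma Isom.symm {C : ChevalleySystem V} {D : ChevalleySystem W} (h : C.Isom D) : D.Isom C := by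
  obtain ⟨T, hT⟩ := h
  refine ⟨T.symm, fun i v => ?_⟩
  simp [LinearEquiv.symm_apply_eq, hT]

lemma Isom.trans {C : ChevalleySystem V} {D : ChevalleySystem W} {E : ChevalleySystem X}
    (h : C.Isom D) (h' : D.Isom E) : C.Isom E := by
  obtain ⟨T, hT⟩ := h
  obtain ⟨S, hS⟩ := h'
  refine ⟨T.trans S, fun i v => ?_⟩
  simp [hT, hS]

lemma IsIrreducible.of_isom {C : ChevalleySystem V} {D : ChevalleySystem W}
    (hC : C.IsIrreducible) (h : C.Isom D) : D.IsIrreducible := by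
  obtain ⟨T, hT⟩ := h
  have := hC.1
  refine ⟨T.symm.toEquiv.nontrivial, fun U hU => ?_⟩
  have hinv : C.IsInvariant (U.comap (T : V →ₗ[ℂ] W)) := fun i u hu => by
    have := hU i (T u) hu
    rwa [← (hT i u).1, ← (hT i u).2] at this
  refine (hC.2 _ hinv).imp (fun h => ?_) fun h => ?_ <;>
    rw [← Submodule.map_comap_eq_of_surjective T.surjective U]
  · exact h ▸ Submodule.map_bot _
  · exact h ▸ (Submodule.map_top _).trans (LinearMap.range_eq_top.mpr T.surjective)

end ChevalleySystem

/-- Transport of a representation along a linear isomorphism. -/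
noncomputable def Rep.transport {V W : Type} [AddCommGroup V] [Module ℂ V] [AddCommGroup W]
    [Module ℂ W] (ρ : Rep V) (T : V ≃ₗ[ℂ] W) : Rep W :=
  { toFun := fun X => T.lieConj (ρ X)
    map_add' := fun X Y => by rw [map_add, map_add]
    map_smul' := fun c X => by
      rw [map_smul]
      exact (T.lieConj : Module.End ℂ V →ₗ[ℂ] Module.End ℂ W).map_smul_of_tower c _
    map_lie' := fun {X Y} => by rw [LieHom.map_lie, LieEquiv.map_lie] }

lemma Rep.isom_transport {V W : Type} [AddCommGroup V] [Module ℂ V] [AddCommGroup W]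
    [Module ℂ W] (ρ : Rep V) (T : V ≃ₗ[ℂ] W) : ρ.Isom (ρ.transport T) :=
  ⟨T, fun X v => by simp [Rep.transport, LinearEquiv.lieConj_apply]⟩

/-- The dimension of the irreducible representation of highest weight `(p, q)`. -/
def weylDim (x : ℕ × ℕ) : ℕ := (x.1 + 1) * (x.2 + 1) * (x.1 + x.2 + 2) / 2

lemma finrank_gtSpace_eq_weylDim (p q : ℕ) : Module.finrank ℂ (gtSpace p q) = weylDim (p, q) := by
  rw [weylDim, ← finrank_gtSpace, Nat.mul_div_cancel_left _ two_pos]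

/-- The natural number division in `weylDim` is exact because twice a dimension equals the product.
-/
lemma two_mul_weylDim (x : ℕ × ℕ) : 2 * weylDim x = (x.1 + 1) * (x.2 + 1) * (x.1 + x.2 + 2) := by
  rw [← finrank_gtSpace_eq_weylDim, finrank_gtSpace]

lemma exists_irrep_isom (p q : ℕ) :
    ∃ ρ : Irrep (weylDim (p, q)), (gtSystem p q).Isom ρ.1.chevalley := by
  have hdim : Module.finrank ℂ (gtSpace p q) = Module.finrank ℂ (Fin (weylDim (p, q)) → ℂ) := by
    rw [finrank_gtSpace_eq_weylDim, Module.finrank_fin_fun]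
  have h := (Rep.isom_iff _ _).mp (((gtSystem p q).toRep gtSystem_serre_e
    gtSystem_serre_f).isom_transport (LinearEquiv.ofFinrankEq _ _ hdim))
  rw [ChevalleySystem.chevalley_toRep] at h
  exact ⟨⟨_, (Rep.isIrreducible_iff _).mpr ((gtSystem_isIrreducible p q).of_isom h)⟩, h⟩

lemma exists_isom_gtSystem {d : ℕ} (ρ : Irrep d) :
    ∃ p q, weylDim (p, q) = d ∧ (gtSystem p q).Isom ρ.1.chevalley := by
  have hirr := (Rep.isIrreducible_iff _).mp ρ.2
  have := hirr.1
  obtain ⟨μ, v, hv⟩ := ρ.1.chevalley.exists_isHighestWeightVector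
  obtain ⟨p, hp⟩ := hv.exists_nat 0
  obtain ⟨q, hq⟩ := hv.exists_nat 1
  obtain rfl : μ = ![(p : ℂ), (q : ℂ)] := by
    funext i
    fin_cases i
    · exact hp
    · exact hq
  have h := ChevalleySystem.isom_of_isHighestWeightVector (gtSystem_isIrreducible p q) hirr
    (isHighestWeightVector_gtVector p q) hv
  refine ⟨p, q, ?_, h⟩
  obtain ⟨T, -⟩ := h
  rw [← finrank_gtSpace_eq_weylDim, T.finrank_eq, Module.finrank_fin_fun]

lemma eq_of_gtSystem_isom {p q p' q' : ℕ} (h : (gtSystem p q).Isom (gtSystem p' q')) :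
    (p, q) = (p', q') := by
  obtain ⟨T, hT⟩ := h
  have h := gtSystem_highestWeight_unique ((isHighestWeightVector_gtVector p q).map T hT)
  have h0 := congrFun h 0
  have h1 := congrFun h 1
  simp only [Matrix.cons_val_zero, Matrix.cons_val_one, Nat.cast_inj] at h0 h1
  rw [h0, h1]

/-- The classification of the irreducible representations by their highest weights. -/
theorem nonempty_irrepClass_equiv (d : ℕ) :
    Nonempty (IrrepClass d ≃ {x : ℕ × ℕ // weylDim x = d}) := by
  have hex (x : {x : ℕ × ℕ // weylDim x = d}) :
      ∃ ρ : Irrep d, (gtSystem x.1.1 x.1.2).Isom ρ.1.chevalley := by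
    obtain ⟨⟨p, q⟩, rfl⟩ := x
    exact exists_irrep_isom p q
  choose r hr using hex
  refine ⟨(Equiv.ofBijective (fun x => (Quotient.mk (irrepSetoid d) (r x) : IrrepClass d))
    ⟨fun x y hxy => ?_, fun c => ?_⟩).symm⟩
  · have h := (Rep.isom_iff _ _).mp (Quotient.exact hxy)
    exact Subtype.ext (eq_of_gtSystem_isom (((hr x).trans h).trans (hr y).symm))
  · induction c using Quotient.ind with
    | _ ρ =>
      obtain ⟨p, q, hd, h⟩ := exists_isom_gtSystem ρ
      exact ⟨⟨(p, q), hd⟩, Quotient.sound ((Rep.isom_iff _ _).mpr ((hr _).symm.trans h))⟩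

/-- The fibres of `weylDim`, taken over all dimensions, make up all pairs. -/
theorem nonempty_irrepClassBelow_equiv (t : ℝ) :
    Nonempty (IrrepClassBelow t ≃ {x : ℕ × ℕ // (weylDim x : ℝ) < t}) := by
  let E : (Σ d, IrrepClass d) ≃ ℕ × ℕ :=
    (Equiv.sigmaCongrRight fun d => (nonempty_irrepClass_equiv d).some).trans
      (Equiv.sigmaFiberEquiv weylDim)
  refine ⟨E.subtypeEquiv fun c => ?_⟩
  have : weylDim (E c) = c.1 := ((nonempty_irrepClass_equiv c.1).some c.2).2
  rw [this]

end SU3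

/-! ### Counting the pairs of bounded dimension. -/

namespace SU3

/-- The pairs `(p, q)` with `p + q + 2 = x` of dimension at most `r`, indexed by `p`. -/
noncomputable def smallWeights (r : ℕ) (x : ℤ) : Finset ℤ :=
  (Finset.Icc 0 (x - 2)).filter fun y => ¬ 2 * (r : ℤ) + 1 ≤ (y + 1) * (x - 1 - y) * x

/-- The pairs `(p, q)` with `p + q + 2 = x` of dimension greater than `r`, indexed by `p`. -/
noncomputable def largeWeights (r : ℕ) (x : ℤ) : Finset ℤ :=
  (Finset.Icc 0 (x - 2)).filter fun y => 2 * (r : ℤ) + 1 ≤ (y + 1) * (x - 1 - y) * x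

lemma card_smallWeights (r : ℕ) {x : ℤ} (hx : 1 ≤ x) :
    ((smallWeights r x).card : ℝ) = (x - 1) - (largeWeights r x).card := by
  have h := Finset.card_filter_add_card_filter_not (s := Finset.Icc 0 (x - 2))
    (fun y => 2 * (r : ℤ) + 1 ≤ (y + 1) * (x - 1 - y) * x)
  rw [Int.card_Icc] at h
  have h' : ((largeWeights r x).card : ℤ) + (smallWeights r x).card = x - 1 := by
    rw [largeWeights, smallWeights]
    omega
  rw [eq_sub_iff_add_eq']
  exact_mod_cast h'

/-- The hypothesis says `(2 * x - 1) ^ 2 ≤ 1 + 8 * r`; this is what cuts the count off at `lBound`.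
-/
lemma le_lBound {r : ℕ} {x : ℤ} (h : x * (x - 1) ≤ 2 * r) : x ≤ lBound ((r : ℝ) + 1 / 2) := by
  rw [lBound, Int.le_floor]
  have h' : (x : ℝ) * (x - 1) ≤ 2 * r := by exact_mod_cast h
  have : 2 * (x : ℝ) - 1 ≤ √(1 + 8 * ((r : ℝ) + 1 / 2)) := by
    apply Real.le_sqrt_of_sq_le
    nlinarith
  linarith

/-- Irreducible representations of dimension at most `r` as pairs `(p + q + 2, p)`. -/
noncomputable def weightsEquiv (r : ℕ) : {x : ℕ × ℕ // weylDim x ≤ r} ≃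
    ↥((Finset.Icc 1 (lBound ((r : ℝ) + 1 / 2))).sigma (smallWeights r)) where
  toFun x := ⟨⟨x.1.1 + x.1.2 + 2, x.1.1⟩, by
    obtain ⟨⟨p, q⟩, hx⟩ := x
    have h := two_mul_weylDim (p, q)
    have h2 : (((p : ℤ) + 1) * (q + 1) * (p + q + 2)) ≤ 2 * r := by
      exact_mod_cast h ▸ Nat.mul_le_mul_left 2 hx
    simp only [Finset.mem_sigma, Finset.mem_Icc, smallWeights, Finset.mem_filter]
    refine ⟨⟨by omega, le_lBound (le_trans ?_ h2)⟩, by omega, ?_⟩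
    -- With `x = p + q + 2`, this is `x - 1 ≤ (p + 1) (q + 1)` multiplied by `x`; the difference is
    -- `p * q * x`.
    · nlinarith [mul_nonneg (Int.natCast_nonneg p) (Int.natCast_nonneg q),
        mul_nonneg (mul_nonneg (Int.natCast_nonneg p) (Int.natCast_nonneg q))
          (by omega : (0 : ℤ) ≤ p + q + 2)]
    · rw [not_le, show (p : ℤ) + q + 2 - 1 - p = q + 1 by ring]
      omega⟩
  invFun z := ⟨(z.1.2.toNat, (z.1.1 - 2 - z.1.2).toNat), by
    obtain ⟨⟨x, y⟩, hz⟩ := z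
    simp only [Finset.mem_sigma, Finset.mem_Icc, smallWeights, Finset.mem_filter] at hz
    obtain ⟨-, ⟨hy, hy'⟩, h⟩ := hz
    lift y to ℕ using hy
    obtain ⟨k, hk⟩ := Int.eq_ofNat_of_zero_le (by omega : 0 ≤ x - 2 - y)
    obtain rfl : x = y + k + 2 := by omega
    have h1 := two_mul_weylDim (y, k)
    have h2 : ((y : ℤ) + 1) * (y + k + 2 - 1 - y) * (y + k + 2) = 2 * weylDim (y, k) := by
      rw [show (y : ℤ) + k + 2 - 1 - y = k + 1 by ring]
      exact_mod_cast h1.symm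
    rw [h2] at h
    have h3 : ((y : ℤ) + k + 2 - 2 - y).toNat = k := by omega
    simp only [h3, Int.toNat_natCast]
    omega⟩
  left_inv x := Subtype.ext <| Prod.ext (by simp) (by simp only; omega)
  right_inv z := Subtype.ext <| by
    obtain ⟨⟨x, y⟩, hz⟩ := z
    simp only [Finset.mem_sigma, Finset.mem_Icc, smallWeights, Finset.mem_filter] at hz
    obtain ⟨-, ⟨hy, hy'⟩, -⟩ := hz
    have h1 : y + ((x - 2 - y).toNat : ℤ) + 2 = x := by omega
    have h2 : (y.toNat : ℤ) = y := by omega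
    simp only [h2]
    rw [h1]

/-- The factors `y + 1` and `x - 1 - y` have sum `x`, so their product is at most `x ^ 2 / 4`, while
`x ≤ kBound` means `x ^ 3 ≤ 8 t`. -/
lemma largeWeights_eq_empty {r : ℕ} {x : ℤ} (hx : 1 ≤ x) (hk : x ≤ kBound ((r : ℝ) + 1 / 2)) :
    largeWeights r x = ∅ := by
  rw [kBound, Int.le_floor] at hk
  refine Finset.filter_eq_empty_iff.mpr fun y hy hle => ?_
  rw [Finset.mem_Icc] at hy
  have ht : (0 : ℝ) ≤ (r : ℝ) + 1 / 2 := by positivity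
  have hcube : (x : ℝ) ^ 3 ≤ 8 * ((r : ℝ) + 1 / 2) := by
    calc (x : ℝ) ^ 3 ≤ (2 * ((r : ℝ) + 1 / 2) ^ (1 / 3 : ℝ)) ^ 3 := by
          gcongr
      _ = 8 * ((r : ℝ) + 1 / 2) := by
          rw [mul_pow, ← Real.rpow_natCast (((r : ℝ) + 1 / 2) ^ (1 / 3 : ℝ)), ← Real.rpow_mul ht]
          norm_num
  have hcube' : x ^ 3 ≤ 8 * r + 4 := by
    have : (x : ℝ) ^ 3 ≤ 8 * r + 4 := by linarith
    exact_mod_cast this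
  -- The cubic bound only gives at most `2 * r + 1`; evenness excludes equality.
  have hc : ((y + 1) * (x - 1 - y) * x) % 2 = 0 := by
    rcases Int.emod_two_eq_zero_or_one x with hx2 | hx2 <;>
      rcases Int.emod_two_eq_zero_or_one y with hy2 | hy2 <;>
      simp [Int.mul_emod, Int.sub_emod, Int.add_emod, hx2, hy2]
  have h4 : 4 * ((y + 1) * (x - 1 - y)) ≤ x ^ 2 := by nlinarith [sq_nonneg (2 * y + 2 - x)]
  have h5 : 4 * ((y + 1) * (x - 1 - y) * x) ≤ x ^ 3 := by nlinarith
  omega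

/-- Completing the square turns the inequality into `(2 y + 2 - x) ^ 2 ≤ x ^ 2 - 8 t / x`, that is,
`y₋ ≤ y ≤ y₊`. The right side is nonnegative because `x` exceeds `kBound`. -/
lemma card_largeWeights {r : ℕ} {x : ℤ} (hx : kBound ((r : ℝ) + 1 / 2) + 1 ≤ x) :
    ((largeWeights r x).card : ℝ) =
      (⌊yPlus ((r : ℝ) + 1 / 2) x⌋ : ℝ) - ⌈yMinus ((r : ℝ) + 1 / 2) x⌉ + 1 := by
  have ht : (0 : ℝ) ≤ (r : ℝ) + 1 / 2 := by positivity
  have hx' : 2 * ((r : ℝ) + 1 / 2) ^ (1 / 3 : ℝ) < x := Int.floor_lt.mp (Int.lt_of_add_one_le hx)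
  have hx0 : (0 : ℝ) < x := lt_of_le_of_lt (by positivity) hx'
  have hx0' : 0 < x := by exact_mod_cast hx0
  have hcube : 8 * ((r : ℝ) + 1 / 2) ≤ (x : ℝ) ^ 3 := by
    calc 8 * ((r : ℝ) + 1 / 2) = (2 * ((r : ℝ) + 1 / 2) ^ (1 / 3 : ℝ)) ^ 3 := by
          rw [mul_pow, ← Real.rpow_natCast (((r : ℝ) + 1 / 2) ^ (1 / 3 : ℝ)), ← Real.rpow_mul ht]
          norm_num
      _ ≤ (x : ℝ) ^ 3 := by gcongr
  have hdisc : 0 ≤ (x : ℝ) ^ 2 - 8 * ((r : ℝ) + 1 / 2) / x := by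
    rw [sub_nonneg, div_le_iff₀ hx0]
    linarith
  have key : largeWeights r x =
      Finset.Icc ⌈yMinus ((r : ℝ) + 1 / 2) x⌉ ⌊yPlus ((r : ℝ) + 1 / 2) x⌋ := by
    ext y
    rw [Finset.mem_Icc, Int.ceil_le, Int.le_floor, largeWeights, Finset.mem_filter,
      Finset.mem_Icc]
    have h1 : (yMinus ((r : ℝ) + 1 / 2) x ≤ y ∧ (y : ℝ) ≤ yPlus ((r : ℝ) + 1 / 2) x) ↔
        |2 * (y : ℝ) - x + 2| ≤ √((x : ℝ) ^ 2 - 8 * ((r : ℝ) + 1 / 2) / x) := by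
      rw [abs_le, yMinus, yPlus]
      constructor <;> rintro ⟨h, h'⟩ <;> constructor <;> linarith
    have h2 : (2 * (y : ℝ) - x + 2) ^ 2 ≤ (x : ℝ) ^ 2 - 8 * ((r : ℝ) + 1 / 2) / x ↔
        2 * (r : ℤ) + 1 ≤ (y + 1) * (x - 1 - y) * x := by
      rw [le_sub_comm, div_le_iff₀ hx0, ← @Int.cast_le ℝ]
      push_cast
      constructor <;> intro h <;> linarith
    rw [h1, Real.le_sqrt (abs_nonneg _) hdisc, sq_abs, h2]
    refine ⟨fun h => h.2, fun h => ⟨?_, h⟩⟩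
    -- The range `0 ≤ y ≤ x - 2` is automatic: the two factors have the same sign and positive sum
    -- `x`.
    have hpos : 0 < (y + 1) * (x - 1 - y) := by
      by_contra hneg
      nlinarith
    rcases (mul_pos_iff.mp hpos) with h | h <;> omega
  -- Even when no integer lies between the roots, floor minus ceiling plus one is nonnegative, so
  -- `toNat` in the cardinality of the interval truncates nothing.
  have hle : ⌈yMinus ((r : ℝ) + 1 / 2) x⌉ ≤ ⌊yPlus ((r : ℝ) + 1 / 2) x⌋ + 1 := by
    rw [Int.ceil_le]
    push_cast
    refine le_trans ?_ (Int.lt_floor_add_one _).le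
    rw [yMinus, yPlus]
    linarith [Real.sqrt_nonneg ((x : ℝ) ^ 2 - 8 * ((r : ℝ) + 1 / 2) / x)]
  have hcard : ((largeWeights r x).card : ℤ) =
      ⌊yPlus ((r : ℝ) + 1 / 2) x⌋ - ⌈yMinus ((r : ℝ) + 1 / 2) x⌉ + 1 := by
    rw [key, Int.card_Icc, Int.toNat_of_nonneg (by omega)]
    ring
  exact_mod_cast hcard

lemma sum_Icc_sub_one {l : ℤ} (hl : 0 ≤ l) :
    ∑ x ∈ Finset.Icc 1 l, ((x : ℝ) - 1) = 1 / 2 * l * (l - 1) := by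
  lift l to ℕ using hl
  induction l with
  | zero => simp
  | succ n ih =>
    push_cast at ih ⊢
    have : Finset.Icc (1 : ℤ) (n + 1) = insert ((n : ℤ) + 1) (Finset.Icc 1 (n : ℤ)) := by
      ext y
      simp only [Finset.mem_insert, Finset.mem_Icc]
      omega
    rw [this, Finset.sum_insert (by simp), ih]
    push_cast
    ring

instance (r : ℕ) : Finite {x : ℕ × ℕ // weylDim x ≤ r} := Finite.of_equiv _ (weightsEquiv r).symm

/-- The explicit expression counts the pairs `(p, q)` of dimension at most `r`. -/
theorem card_weylDim_le (r : ℕ) :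
    (Nat.card {x : ℕ × ℕ // weylDim x ≤ r} : ℝ) = N ((r : ℝ) + 1 / 2) := by
  have hl : 0 ≤ lBound ((r : ℝ) + 1 / 2) := Int.floor_nonneg.mpr (by positivity)
  have hk : 0 ≤ kBound ((r : ℝ) + 1 / 2) := Int.floor_nonneg.mpr (by positivity)
  rw [Nat.card_congr (weightsEquiv r), Nat.card_eq_fintype_card, Fintype.card_coe,
    Finset.card_sigma, Nat.cast_sum, N]
  rw [Finset.sum_congr rfl fun x hx => card_smallWeights r (Finset.mem_Icc.mp hx).1,
    Finset.sum_sub_distrib, sum_Icc_sub_one hl]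
  congr 1
  rw [← Finset.sum_congr rfl fun x hx => card_largeWeights (Finset.mem_Icc.mp hx).1]
  -- The count runs over `x ≥ 1`, the sum in `N` over `x ≥ kBound + 1`; the extra terms are zero.
  refine (Finset.sum_subset (Finset.Icc_subset_Icc_left (by omega)) fun x hx hx' => ?_).symm
  rw [Finset.mem_Icc] at hx hx'
  rw [largeWeights_eq_empty hx.1 (by omega), Finset.card_empty, Nat.cast_zero]

theorem nonempty_irrepClassBelow_equiv_le (r : ℕ) :
    Nonempty (IrrepClassBelow ((r : ℝ) + 1 / 2) ≃ {x : ℕ × ℕ // weylDim x ≤ r}) := by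
  refine ⟨(nonempty_irrepClassBelow_equiv _).some.trans (Equiv.subtypeEquivRight fun x => ?_)⟩
  constructor
  · intro h
    have : (weylDim x : ℝ) < (r + 1 : ℕ) := by push_cast; linarith
    exact Nat.lt_succ_iff.mp (by exact_mod_cast this)
  · intro h
    have : (weylDim x : ℝ) ≤ r := by exact_mod_cast h
    linarith

lemma card_weylDim_eq (r : ℕ) : Nat.card {x : ℕ × ℕ // weylDim x ≤ r + 1} =
    Nat.card {x : ℕ × ℕ // weylDim x ≤ r} + Nat.card {x : ℕ × ℕ // weylDim x = r + 1} := by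
  have : Finite {x : ℕ × ℕ // weylDim x = r + 1} :=
    Finite.of_injective (β := {x : ℕ × ℕ // weylDim x ≤ r + 1}) (fun x => ⟨x.1, x.2.le⟩)
      fun x y h => Subtype.ext (Subtype.mk.inj h)
  rw [← Nat.card_sum]
  refine Nat.card_congr ((Equiv.subtypeEquivRight fun x => Nat.le_succ_iff).trans
    (subtypeOrEquiv _ _ ?_))
  rw [Pi.disjoint_iff]
  intro x
  simp only [Prop.disjoint_iff]
  omega

end SU3

theorem mainTheorem4 (D : ℕ) (hD : 1 ≤ D) :
    -- the isomorphism classes being counted form finite sets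
    Finite (SU3.IrrepClass D) ∧
    Finite (SU3.IrrepClassBelow ((D : ℝ) + 1 / 2)) ∧
    Finite (SU3.IrrepClassBelow ((D : ℝ) - 1 / 2)) ∧
    -- the explicit expression `N` is the counting function at the two points used
    (SU3.countBelow ((D : ℝ) + 1 / 2) : ℝ) = SU3.N ((D : ℝ) + 1 / 2) ∧
    (SU3.countBelow ((D : ℝ) - 1 / 2) : ℝ) = SU3.N ((D : ℝ) - 1 / 2) ∧
    -- the formula for the number of irreducible representations of dimension `D`
    (SU3.xi D : ℝ) = SU3.N ((D : ℝ) + 1 / 2) - SU3.N ((D : ℝ) - 1 / 2) := by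
  -- With `D = r + 1`, both evaluation points have the form of a natural number plus `1/2`.
  obtain ⟨r, rfl⟩ : ∃ r, D = r + 1 := ⟨D - 1, by omega⟩
  have ht : ((r + 1 : ℕ) : ℝ) - 1 / 2 = (r : ℝ) + 1 / 2 := by push_cast; ring
  rw [ht]
  obtain ⟨E⟩ := SU3.nonempty_irrepClass_equiv (r + 1)
  obtain ⟨F⟩ := SU3.nonempty_irrepClassBelow_equiv_le (r + 1)
  obtain ⟨G⟩ := SU3.nonempty_irrepClassBelow_equiv_le r
  refine ⟨?_, Finite.of_equiv _ F.symm, Finite.of_equiv _ G.symm, ?_, ?_, ?_⟩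
  · exact Finite.of_injective
      (fun c => (⟨(E c).1, (E c).2.le⟩ : {x : ℕ × ℕ // SU3.weylDim x ≤ r + 1}))
      fun x y h => E.injective (Subtype.ext (Subtype.mk.inj h))
  · rw [SU3.countBelow, Nat.card_congr F, SU3.card_weylDim_le]
  · rw [SU3.countBelow, Nat.card_congr G, SU3.card_weylDim_le]
  · rw [SU3.xi, Nat.card_congr E, ← SU3.card_weylDim_le, ← SU3.card_weylDim_le,
      SU3.card_weylDim_eq, Nat.cast_add, add_sub_cancel_left]
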